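/- Let $\mathcal K\neq\{0\}$ be a separable complex Hilbert space and $\mathbb R^+=[0,\infty)$. The Hardy space $\mathcal H^2(\mathbb C^+;\mathcal K)$ consists of the functions $F:\mathbb C^+\to\mathcal K$, analytic in the open upper half-plane, with $\sup_{y>0}\int_{\mathbb R}\|F(x+iy)\|^2\,dx<\infty$. Let $\mathcal H^2_+(\mathbb R;\mathcal K)\subset L^2(\mathbb R;\mathcal K)$ be the (closed) subspace of boundary value functions $f(x)=\lim_{y\to0^+}F(x+iy)$ (a.e. $x$) of such $F$, and $P_+$ the orthogonal projection of $L^2(\mathbb R;\mathcal K)$ onto it. Let $L^2(\mathbb R^+;\mathcal K)\subset L^2(\mathbb R;\mathcal K)$ be the subspace of functions supported on $\mathbb R^+$, with orthogonal projection $P_{\mathbb R^+}$, let $[u_+(t)f](E)=e^{-iEt}f(E)$ on $L^2(\mathbb R^+;\mathcal K)$, and put $$M_F:=P_{\mathbb R^+}P_+P_{\mathbb R^+}\big|_{L^2(\mathbb R^+;\mathcal K)},\qquad \Lambda_F:=M_F^{1/2}$$ (the positive square root). Then $\Lambda_F$ is injective with dense range, and for every $t\ge 0$ the operator $\Lambda_F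 u_+(t)\Lambda_F^{-1}$, defined on the range of $\Lambda_F$, extends to a bounded operator $Z(t)$ on $L^2(\mathbb R^+;\mathcal K)$, so that $Z(t)\Lambda_F=\Lambda_F u_+(t)$. There exists a non-negative self-adjoint operator $T$ with dense domain in $L^2(\mathbb R^+;\mathcal K)$, whose spectrum is $\sigma(T)=[0,\infty)$ and consists of continuous spectrum only (for every $\lambda\in\sigma(T)$, $T-\lambda$ is injective with dense range), and whose spectral projection valued measure $\mu_T$ on the Borel sets of $\mathbb R^+$ (so $T=\int_0^\infty s\,d\mu_T(s)$) satisfies, for every $t\ge 0$, $$\mu_T([0,t])L^2(\mathbb R^+;\mathcal K)=[Z(t),Z^*(t)]L^2(\mathbb R^+;\mathcal K)=\operatorname{Ker}Z(t),$$ $$\mu_T([t,\infty))L^2(\mathbb R^+;\mathcal K)=Z^*(t)Z(t)L^2(\mathbb R^+;\mathcal K)=(\operatorname{Ker}Z(t))^\perp.$$ In particular $\operatorname{Ker}Z(t_1)\subsetneq\operatorname{Ker}Z(t_2)$ for $0\le t_1<t_2$, $\operatorname{Ker}Z(0)=\{0\}$, and $\lim_{t\to\infty}\operatorname{Ker}Z(t)=L^2(\mathbb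 R^+;\mathcal K)$, in the sense that the orthogonal projections onto $\operatorname{Ker}Z(t)$ converge strongly to the identity as $t\to\infty$. -/

import Mathlib

open MeasureTheory Filter Topology
open scoped NNReal ENNReal InnerProductSpace

namespace TimeOrdering

noncomputable section

/-- The positive square root of a non-negative bounded operator. -/
def opSqrt {H : Type*} [NormedAddCommGroup H] [InnerProductSpace ℂ H] [CompleteSpace H]
    (A : H →L[ℂ] H) : H →L[ℂ] H :=
  CFC.sqrt A

section Hardy

variable (K : Type*) [NormedAddCommGroup K] [InnerProductSpace ℂ K]

/-- The Hilbert space `L²(ℝ; K)` of (classes of) square integrable `K`-valued functions. -/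
abbrev L2Line : Type _ := Lp K 2 (volume : Measure ℝ)

variable {K} in
/-- `F` belongs to the Hardy space `H²(ℂ⁺; K)` of the upper half-plane: it is analytic for
`Im z > 0`, and the integrals of `‖F(x + iy)‖²` over the horizontal lines are bounded, uniformly
in `y > 0`. -/
def IsHardyUpper (F : ℂ → K) : Prop :=
  DifferentiableOn ℂ F {z : ℂ | 0 < z.im} ∧
    ∃ C : ℝ≥0, ∀ y : ℝ, 0 < y → ∫⁻ x : ℝ, ‖F (x + y * Complex.I)‖ₑ ^ 2 ≤ C

variable {K} in
/-- `f ∈ L²(ℝ; K)` is the boundary value function of `F : ℂ⁺ → K`: for almost every `x`,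
`F(x + iy) → f(x)` in `K` as `y → 0⁺`. -/
def IsBoundaryValue (F : ℂ → K) (f : L2Line K) : Prop :=
  ∀ᵐ x : ℝ, Tendsto (fun y : ℝ => F (x + y * Complex.I)) (𝓝[>] 0) (𝓝 (f x))

theorem IsHardyUpper.continuous_line {F : ℂ → K} (hF : IsHardyUpper F) {y : ℝ} (hy : 0 < y) :
    Continuous fun x : ℝ => F (x + y * Complex.I) := by
  refine hF.1.continuousOn.comp_continuous (by fun_prop) fun x => ?_
  simpa using hy

theorem IsHardyUpper.add {F G : ℂ → K} (hF : IsHardyUpper F) (hG : IsHardyUpper G) :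
    IsHardyUpper (F + G) := by
  refine ⟨hF.1.add hG.1, ?_⟩
  obtain ⟨C, hC⟩ := hF.2
  obtain ⟨D, hD⟩ := hG.2
  refine ⟨2 * C + 2 * D, fun y hy => ?_⟩
  have hm : Measurable fun x : ℝ => 2 * ‖F (x + y * Complex.I)‖ₑ ^ 2 :=
    ((hF.continuous_line K hy).enorm.measurable.pow_const 2).const_mul 2
  calc ∫⁻ x : ℝ, ‖(F + G) (x + y * Complex.I)‖ₑ ^ 2
      ≤ ∫⁻ x : ℝ, (2 * ‖F (x + y * Complex.I)‖ₑ ^ 2 + 2 * ‖G (x + y * Complex.I)‖ₑ ^ 2) := by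
        refine lintegral_mono fun x => ?_
        simp only [enorm, Pi.add_apply]
        norm_cast
        have h := nnnorm_add_le (F (x + y * Complex.I)) (G (x + y * Complex.I))
        refine (pow_le_pow_left₀ (zero_le) h 2).trans ?_
        rw [← NNReal.coe_le_coe]
        push_cast
        nlinarith [sq_nonneg (‖F (x + y * Complex.I)‖ - ‖G (x + y * Complex.I)‖)]
    _ = 2 * (∫⁻ x : ℝ, ‖F (x + y * Complex.I)‖ₑ ^ 2)
          + 2 * ∫⁻ x : ℝ, ‖G (x + y * Complex.I)‖ₑ ^ 2 := by
        rw [lintegral_add_left hm, lintegral_const_mul' _ _ (by simp),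
          lintegral_const_mul' _ _ (by simp)]
    _ ≤ ((2 * C + 2 * D : ℝ≥0) : ℝ≥0∞) := by
        push_cast
        gcongr
        · exact hC y hy
        · exact hD y hy

theorem IsHardyUpper.const_smul {F : ℂ → K} (c : ℂ) (hF : IsHardyUpper F) :
    IsHardyUpper (c • F) := by
  refine ⟨hF.1.const_smul c, ?_⟩
  obtain ⟨C, hC⟩ := hF.2
  refine ⟨‖c‖₊ ^ 2 * C, fun y hy => ?_⟩
  simp only [Pi.smul_apply, enorm_smul, mul_pow]
  rw [lintegral_const_mul' _ _ (by simp)]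
  push_cast
  gcongr
  · exact le_rfl
  · exact hC y hy

theorem isHardyUpper_zero : IsHardyUpper (0 : ℂ → K) :=
  ⟨differentiableOn_const 0, 0, fun y _ => by simp⟩

/-- The Hardy space `H²₊(ℝ; K) ⊆ L²(ℝ; K)` of boundary value functions on `ℝ` of the functions in
`H²(ℂ⁺; K)`. -/
def hardyPlus : Submodule ℂ (L2Line K) where
  carrier := {f | ∃ F : ℂ → K, IsHardyUpper F ∧ IsBoundaryValue F f}
  zero_mem' := by
    refine ⟨0, isHardyUpper_zero K, ?_⟩
    filter_upwards [Lp.coeFn_zero K 2 (volume : Measure ℝ)] with x hx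
    simpa only [hx, Pi.zero_apply] using tendsto_const_nhds
  add_mem' := by
    rintro f g ⟨F, hF, hf⟩ ⟨G, hG, hg⟩
    refine ⟨F + G, hF.add K hG, ?_⟩
    filter_upwards [hf, hg, Lp.coeFn_add f g] with x h1 h2 h3
    rw [h3]
    exact h1.add h2
  smul_mem' := by
    rintro c f ⟨F, hF, hf⟩
    refine ⟨c • F, hF.const_smul K c, ?_⟩
    filter_upwards [hf, Lp.coeFn_smul c f] with x h1 h2
    rw [h2]
    exact h1.const_smul c

/-- The subspace `L²(ℝ⁺; K)` of `L²(ℝ; K)` of the functions that are supported on `ℝ⁺ = [0, ∞)`. -/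
def L2Pos : Submodule ℂ (L2Line K) where
  carrier := {f | ∀ᵐ x : ℝ, x < 0 → f x = 0}
  zero_mem' := by
    filter_upwards [Lp.coeFn_zero K 2 (volume : Measure ℝ)] with x hx _
    rw [hx, Pi.zero_apply]
  add_mem' := by
    intro f g hf hg
    filter_upwards [hf, hg, Lp.coeFn_add f g] with x h1 h2 h3 hx
    rw [h3, Pi.add_apply, h1 hx, h2 hx, add_zero]
  smul_mem' := by
    intro c f hf
    filter_upwards [hf, Lp.coeFn_smul c f] with x h1 h2 hx
    rw [h2, Pi.smul_apply, h1 hx, smul_zero]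

variable {K} in
theorem mem_L2Pos {f : L2Line K} : f ∈ L2Pos K ↔ ∀ᵐ x : ℝ, x < 0 → f x = 0 := Iff.rfl

theorem isClosed_L2Pos : IsClosed (L2Pos K : Set (L2Line K)) := by
  have h : (L2Pos K : Set (L2Line K)) =
      (LpToLpRestrictCLM ℝ K ℂ (volume : Measure ℝ) 2 (Set.Iio 0)) ⁻¹' {0} := by
    ext f
    rw [SetLike.mem_coe, mem_L2Pos, Set.mem_preimage, Set.mem_singleton_iff,
      Lp.eq_zero_iff_ae_eq_zero]
    have h1 := LpToLpRestrictCLM_coeFn (F := K) ℂ (μ := (volume : Measure ℝ)) (p := 2)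
      (Set.Iio 0) f
    have h2 := ae_restrict_iff' (μ := (volume : Measure ℝ)) (p := fun x : ℝ => f x = 0)
      (s := Set.Iio 0) measurableSet_Iio
    refine h2.symm.trans ⟨fun hf => h1.trans hf, fun hf => h1.symm.trans hf⟩
  rw [h]
  exact isClosed_singleton.preimage (ContinuousLinearMap.continuous _)

/-- `[u(t) f](σ) = e^{-iσt} f(σ)` is square integrable if `f` is. -/
theorem memLp_phase (t : ℝ) (f : L2Line K) :
    MemLp (fun σ : ℝ => Complex.exp (-(Complex.I * σ * t)) • f σ) 2 volume := by
  have hc : Continuous fun σ : ℝ => Complex.exp (-(Complex.I * σ * t)) := by fun_prop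
  refine (Lp.memLp f).of_le (hc.aestronglyMeasurable.smul (Lp.aestronglyMeasurable f)) ?_
  refine Eventually.of_forall fun σ => ?_
  have : ‖Complex.exp (-(Complex.I * σ * t))‖ = 1 := by
    simp [Complex.norm_exp]
  rw [norm_smul, this, one_mul]

/-- The evolution `[u(t) f](σ) = e^{-iσt} f(σ)` on `L²(ℝ; K)`. -/
def evol (t : ℝ) : L2Line K →L[ℂ] L2Line K :=
  LinearMap.mkContinuous
    { toFun := fun f => (memLp_phase K t f).toLp _
      map_add' := fun f g => by
        apply Lp.ext
        filter_upwards [(memLp_phase K t (f + g)).coeFn_toLp, (memLp_phase K t f).coeFn_toLp,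
          (memLp_phase K t g).coeFn_toLp, Lp.coeFn_add f g,
          Lp.coeFn_add ((memLp_phase K t f).toLp _) ((memLp_phase K t g).toLp _)]
          with x h1 h2 h3 h4 h5
        rw [h1, h5, Pi.add_apply, h2, h3, h4, Pi.add_apply, smul_add]
      map_smul' := fun c f => by
        apply Lp.ext
        filter_upwards [(memLp_phase K t (c • f)).coeFn_toLp, (memLp_phase K t f).coeFn_toLp,
          Lp.coeFn_smul c f, Lp.coeFn_smul c ((memLp_phase K t f).toLp _)] with x h1 h2 h3 h4
        rw [h1, RingHom.id_apply, h4, Pi.smul_apply, h2, h3, Pi.smul_apply, smul_comm] }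
    1 (fun f => by
      rw [one_mul]
      refine Lp.norm_le_norm_of_ae_le ?_
      filter_upwards [(memLp_phase K t f).coeFn_toLp] with x h1
      have : ‖Complex.exp (-(Complex.I * x * t))‖ = 1 := by
        simp [Complex.norm_exp]
      simp only [LinearMap.coe_mk, AddHom.coe_mk]
      rw [h1, norm_smul, this, one_mul])

theorem evol_coeFn (t : ℝ) (f : L2Line K) :
    evol K t f =ᵐ[volume] fun σ : ℝ => Complex.exp (-(Complex.I * σ * t)) • f σ :=
  (memLp_phase K t f).coeFn_toLp

theorem evol_mem_L2Pos (t : ℝ) {f : L2Line K} (hf : f ∈ L2Pos K) : evol K t f ∈ L2Pos K := by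
  rw [mem_L2Pos] at hf ⊢
  filter_upwards [hf, evol_coeFn K t f] with x h1 h2 hx
  rw [h2, h1 hx, smul_zero]

/-- The Schrödinger evolution in the energy representation, `[u₊(t) f](E) = e^{-iEt} f(E)` on
`L²(ℝ⁺; K)`. -/
def evolPos (t : ℝ) : L2Pos K →L[ℂ] L2Pos K :=
  ((evol K t).comp (L2Pos K).subtypeL).codRestrict (L2Pos K)
    fun f => evol_mem_L2Pos K t f.2

variable [CompleteSpace K]

instance : CompleteSpace (L2Pos K) := (isClosed_L2Pos K).completeSpace_coe

/-- The orthogonal projection `P₊` of `L²(ℝ; K)` onto `H²₊(ℝ; K)`. The Hardy space is a closed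
subspace, so that taking its closure changes nothing; the closure is written only because the
projection operator is available for subspaces that are known to be closed. -/
def projHardy : L2Line K →L[ℂ] L2Line K := (hardyPlus K).topologicalClosure.starProjection

/-- The Lyapunov operator `M_F = P_{ℝ⁺} P₊ P_{ℝ⁺}` restricted to `L²(ℝ⁺; K)`. -/
def lyapunov : L2Pos K →L[ℂ] L2Pos K :=
  (L2Pos K).orthogonalProjectionOnto ∘L projHardy K ∘L (L2Pos K).subtypeL

/-- The `Λ`-transformation: the positive square root `Λ_F = M_F^{1/2}`. -/
def lambdaF : L2Pos K →L[ℂ] L2Pos K := opSqrt (lyapunov K)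

/-- The operator `Z(t)`, `t ≥ 0`: the continuous extension to all of `L²(ℝ⁺; K)` of the operator
`Λ_F u₊(t) Λ_F⁻¹`, which is densely defined, on the range of `Λ_F`. -/
def Z (t : ℝ≥0) : L2Pos K →L[ℂ] L2Pos K :=
  LinearMap.extendOfNorm (lambdaF K ∘L evolPos K (t : ℝ)).toLinearMap (lambdaF K).toLinearMap

end Hardy

section Spectral

variable {H : Type*} [NormedAddCommGroup H] [InnerProductSpace ℂ H] [CompleteSpace H]

/-- A projection valued measure on `α` with values in the orthogonal projections of `H`. Only the
values on measurable sets matter. -/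
structure ProjMeasure (α : Type*) [MeasurableSpace α] (H : Type*) [NormedAddCommGroup H]
    [InnerProductSpace ℂ H] [CompleteSpace H] where
  /-- The projection that belongs to a set. -/
  proj : Set α → H →L[ℂ] H
  isStarProjection : ∀ s, MeasurableSet s → IsStarProjection (proj s)
  proj_empty : proj ∅ = 0
  proj_univ : proj Set.univ = 1
  proj_inter : ∀ s t, MeasurableSet s → MeasurableSet t → proj (s ∩ t) = proj s * proj t
  hasSum_proj : ∀ s : ℕ → Set α, (∀ n, MeasurableSet (s n)) →
    Pairwise (Function.onFun Disjoint s) → ∀ x : H, HasSum (fun n => proj (s n) x)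
      (proj (⋃ n, s n) x)

variable {α : Type*} [MeasurableSpace α]

theorem ProjMeasure.re_inner_nonneg (P : ProjMeasure α H) {s : Set α} (hs : MeasurableSet s)
    (x : H) : 0 ≤ (⟪x, P.proj s x⟫_ℂ).re := by
  have h := P.isStarProjection s hs
  have h1 : P.proj s x = P.proj s (P.proj s x) :=
    (congrArg (fun A : H →L[ℂ] H => A x) h.isIdempotentElem.eq).symm
  have h2 : ⟪x, P.proj s (P.proj s x)⟫_ℂ = ⟪P.proj s x, P.proj s x⟫_ℂ := by
    rw [← ContinuousLinearMap.adjoint_inner_left]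
    rw [h.isSelfAdjoint.adjoint_eq]
  rw [h1, h2]
  exact inner_self_nonneg (𝕜 := ℂ)

/-- The finite positive measure `s ↦ (x, μ(s) x)` of a vector `x`, for a projection valued
measure `μ`. -/
def ProjMeasure.scalar (P : ProjMeasure α H) (x : H) : Measure α :=
  Measure.ofMeasurable (fun s _ => ENNReal.ofReal (⟪x, P.proj s x⟫_ℂ).re)
    (by simp [P.proj_empty])
    (fun s hs hd => by
      have h1 : HasSum (fun n => (⟪x, P.proj (s n) x⟫_ℂ).re) (⟪x, P.proj (⋃ n, s n) x⟫_ℂ).re :=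
        Complex.hasSum_re ((P.hasSum_proj s hs hd x).mapL (innerSL ℂ x))
      rw [← h1.tsum_eq]
      exact ENNReal.ofReal_tsum_of_nonneg (fun n => P.re_inner_nonneg (hs n) x) h1.summable)

theorem ProjMeasure.scalar_apply (P : ProjMeasure α H) (x : H) {s : Set α}
    (hs : MeasurableSet s) :
    P.scalar x s = ENNReal.ofReal (⟪x, P.proj s x⟫_ℂ).re :=
  Measure.ofMeasurable_apply s hs

/-- `μ` is the spectral measure of the operator `T`, i.e. `T = ∫ s dμ(s)` over `[0, ∞)`: the domain
of `T` is the set of all `x` with `∫ s² d(x, μ(s) x) < ∞`, and `(x, T x) = ∫ s d(x, μ(s) x)` for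
these `x`; the second clause determines `T` on its domain by polarization. -/
def IsSpectralMeasure (P : ProjMeasure ℝ≥0 H) (T : H →ₗ.[ℂ] H) : Prop :=
  (∀ x : H, x ∈ T.domain ↔ ∫⁻ s : ℝ≥0, (s : ℝ≥0∞) ^ 2 ∂(P.scalar x) < ∞) ∧
    ∀ x : T.domain, ⟪(x : H), T x⟫_ℂ = ((∫ s : ℝ≥0, (s : ℝ) ∂(P.scalar (x : H)) : ℝ) : ℂ)

/-- The spectrum of an unbounded operator: the numbers `z` for which `T - z` does not have a bounded
everywhere defined two-sided inverse. -/
def spectrumPMap (T : H →ₗ.[ℂ] H) : Set ℂ :=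
  {z | ¬ ∃ R : H →L[ℂ] H,
    (∀ y : H, ∃ h : R y ∈ T.domain, T ⟨R y, h⟩ - z • R y = y) ∧
      ∀ x : T.domain, R (T x - z • (x : H)) = x}

/-- The continuous spectrum of an unbounded operator: the numbers `z` of the spectrum for which
`T - z` is injective and has dense range. -/
def contSpectrumPMap (T : H →ₗ.[ℂ] H) : Set ℂ :=
  {z | z ∈ spectrumPMap T ∧ (∀ x : T.domain, T x = z • (x : H) → x = 0) ∧
    DenseRange fun x : T.domain => T x - z • (x : H)}

end Spectral

end

end TimeOrdering

/-! Up to a unitary equivalence, `Z(t)` is the left translation on the half-line, and the ordering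
operator is multiplication by the position variable. By Paley–Wiener
(`topologicalClosure_hardyPlus`) the Fourier transform `𝓕` carries the Hardy space onto the
functions supported on `[0, ∞)`, so `P₊ = 𝓕⁻¹ P 𝓕` with `P` the half-line projection. Hence `M_F =
A* A` for `A = P 𝓕` restricted to `L²(ℝ⁺; K)` (`fourierCompress`, `lyapunov_eq`). Since `𝓕` turns
the phase `e^{-iEt}` into translation by `t / 2π`, and translation to the left by a non-negative
amount commutes with cutting off the negative half-line, `A u₊(t) = S(t) A` with `S(t)` the left
translation (`fourierCompress_evolPos`). A function supported on a half-line whose Fourier transform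
vanishes on a half-line is zero (`eq_zero_of_fourier_half_line`); therefore `A` is injective with
dense range. In the polar decomposition `A = U Λ_F` the factor `U` is then unitary (`polarUnitary`),
and `U Z(t) = S(t) U` (`shiftEquiv_Z`). Now `S(t) S(t)* = 1`, while `S(t)* S(t)` is multiplication
by the indicator of `[t / 2π, ∞)`. Multiplication by `2πs`, pulled back by `U`, is therefore the
required `T`, and its spectral properties are those of a multiplication operator with continuous
distribution (section `Mult`). -/

namespace TimeOrdering

noncomputable section

set_option linter.unusedSectionVars false

/-! ### Densities `‖f‖²` of square integrable functions. -/

section SqMeasure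

variable {X : Type*} [MeasurableSpace X] {K : Type*} [NormedAddCommGroup K] {ν : Measure X}

/-- The finite measure with density `‖f‖²`. -/
def sqMeasure (f : Lp K 2 ν) : Measure X := ν.withDensity fun x => ‖f x‖ₑ ^ 2

theorem enorm_sq_eq_lintegral (f : Lp K 2 ν) : ‖f‖ₑ ^ 2 = ∫⁻ x, ‖f x‖ₑ ^ 2 ∂ν := by
  rw [Lp.enorm_def, eLpNorm_eq_lintegral_rpow_enorm_toReal (by simp) (by simp)]
  rw [← ENNReal.rpow_natCast, ← ENNReal.rpow_mul]
  simp

end SqMeasure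

/-! ### Bounded multiplication operators on `L²`. -/

section MulOp

variable {X : Type*} [MeasurableSpace X] {K : Type*} [NormedAddCommGroup K]
  [InnerProductSpace ℂ K] {ν : Measure X}

/-- A measurable bounded multiplier. -/
def BddMeas (φ : X → ℂ) : Prop := Measurable φ ∧ ∃ C, ∀ x, ‖φ x‖ ≤ C

theorem BddMeas.memLp {φ : X → ℂ} (h : BddMeas φ) (f : Lp K 2 ν) :
    MemLp (fun x => φ x • f x) 2 ν := by
  obtain ⟨C, hC⟩ := h.2
  refine (Lp.memLp f).of_le_mul (c := C)
    (h.1.aestronglyMeasurable.smul (Lp.aestronglyMeasurable f)) (Eventually.of_forall fun x => ?_)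
  rw [norm_smul]
  gcongr
  exact hC x

theorem BddMeas.mul {φ ψ : X → ℂ} (h : BddMeas φ) (h' : BddMeas ψ) : BddMeas (φ * ψ) := by
  obtain ⟨C, hC⟩ := h.2
  obtain ⟨D, hD⟩ := h'.2
  refine ⟨h.1.mul h'.1, C * D, fun x => ?_⟩
  rw [Pi.mul_apply, norm_mul]
  exact mul_le_mul (hC x) (hD x) (norm_nonneg _) ((norm_nonneg _).trans (hC x))

theorem BddMeas.indicator_one {s : Set X} (hs : MeasurableSet s) :
    BddMeas (s.indicator (1 : X → ℂ)) := by
  refine ⟨measurable_one.indicator hs, 1, fun x => ?_⟩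
  by_cases hx : x ∈ s <;> simp [hx]

theorem BddMeas.const (c : ℂ) : BddMeas fun _ : X => c :=
  ⟨measurable_const, ‖c‖, fun _ => le_rfl⟩

variable (K ν) in
open Classical in
/-- Multiplication by `φ` on `L²`, for a bounded measurable function `φ`. -/
def mulOp (φ : X → ℂ) : Lp K 2 ν →L[ℂ] Lp K 2 ν :=
  if h : BddMeas φ then
    LinearMap.mkContinuous
      { toFun := fun f => (h.memLp f).toLp _
        map_add' := fun f g => by
          apply Lp.ext
          filter_upwards [(h.memLp (f + g)).coeFn_toLp, (h.memLp f).coeFn_toLp,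
            (h.memLp g).coeFn_toLp, Lp.coeFn_add f g,
            Lp.coeFn_add ((h.memLp f).toLp _) ((h.memLp g).toLp _)]
            with x h1 h2 h3 h4 h5
          rw [h1, h5, Pi.add_apply, h2, h3, h4, Pi.add_apply, smul_add]
        map_smul' := fun c f => by
          apply Lp.ext
          filter_upwards [(h.memLp (c • f)).coeFn_toLp, (h.memLp f).coeFn_toLp,
            Lp.coeFn_smul c f, Lp.coeFn_smul c ((h.memLp f).toLp _)] with x h1 h2 h3 h4
          rw [h1, RingHom.id_apply, h4, Pi.smul_apply, h2, h3, Pi.smul_apply, smul_comm] }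
      h.2.choose (fun f => by
        refine Lp.norm_le_mul_norm_of_ae_le_mul ?_
        filter_upwards [(h.memLp f).coeFn_toLp] with x h1
        simp only [LinearMap.coe_mk, AddHom.coe_mk]
        rw [h1, norm_smul]
        gcongr
        exact h.2.choose_spec x)
  -- A default value, which makes `mulOp` total in `φ`.
  else 0

theorem mulOp_coeFn {φ : X → ℂ} (h : BddMeas φ) (f : Lp K 2 ν) :
    mulOp K ν φ f =ᵐ[ν] fun x => φ x • f x := by
  rw [mulOp, dif_pos h]
  exact (h.memLp f).coeFn_toLp

theorem mulOp_mul {φ ψ : X → ℂ} (h : BddMeas φ) (h' : BddMeas ψ) :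
    mulOp K ν (φ * ψ) = mulOp K ν φ * mulOp K ν ψ := by
  ext1 f
  apply Lp.ext
  filter_upwards [mulOp_coeFn (h.mul h') f, mulOp_coeFn h (mulOp K ν ψ f), mulOp_coeFn h' f]
    with x h1 h2 h3
  rw [h1, mul_apply_eq_comp, h2, h3, Pi.mul_apply, mul_smul]

theorem mulOp_one : mulOp K ν (1 : X → ℂ) = 1 := by
  ext1 f
  apply Lp.ext
  filter_upwards [mulOp_coeFn (BddMeas.const 1) f] with x h1
  exact h1.trans (by simp)

theorem mulOp_zero : mulOp K ν (0 : X → ℂ) = 0 := by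
  ext1 f
  apply Lp.ext
  filter_upwards [mulOp_coeFn (BddMeas.const 0) f, Lp.coeFn_zero K 2 ν] with x h1 h2
  refine h1.trans ?_
  rw [zero_smul]
  exact h2.symm

theorem mulOp_sub_indicator {s t : Set X} (hs : MeasurableSet s) (ht : MeasurableSet t)
    (hst : t ⊆ s) :
    mulOp K ν (s.indicator 1) - mulOp K ν (t.indicator 1) =
      mulOp K ν ((s \ t).indicator 1) := by
  ext1 f
  apply Lp.ext
  rw [sub_apply]
  filter_upwards [mulOp_coeFn (.indicator_one hs) f, mulOp_coeFn (.indicator_one ht) f,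
    mulOp_coeFn (.indicator_one (hs.diff ht)) f,
    Lp.coeFn_sub (mulOp K ν (s.indicator 1) f) (mulOp K ν (t.indicator 1) f)] with x h1 h2 h3 h4
  rw [h4, Pi.sub_apply, h1, h2, h3]
  by_cases hxs : x ∈ s <;> by_cases hxt : x ∈ t <;> simp [hxs, hxt]
  exact absurd (hst hxt) hxs

theorem mulOp_inter_indicator {s t : Set X} (hs : MeasurableSet s) (ht : MeasurableSet t) :
    mulOp K ν ((s ∩ t).indicator 1) =
      mulOp K ν (s.indicator 1) * mulOp K ν (t.indicator 1) := by
  rw [← mulOp_mul (.indicator_one hs) (.indicator_one ht)]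
  congr 1
  ext x
  by_cases hxs : x ∈ s <;> by_cases hxt : x ∈ t <;> simp [hxs, hxt]

theorem mulOp_isSelfAdjoint [CompleteSpace K] {φ : X → ℂ} (h : BddMeas φ)
    (hr : ∀ x, star (φ x) = φ x) :
    IsSelfAdjoint (mulOp K ν φ) := by
  rw [ContinuousLinearMap.isSelfAdjoint_iff_isSymmetric]
  intro f g
  simp only [ContinuousLinearMap.coe_coe]
  rw [L2.inner_def, L2.inner_def]
  refine integral_congr_ae ?_
  filter_upwards [mulOp_coeFn h f, mulOp_coeFn h g] with x h1 h2
  rw [h1, h2, inner_smul_left, inner_smul_right]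
  congr 1
  exact hr x

theorem mulOp_isStarProjection [CompleteSpace K] {s : Set X} (hs : MeasurableSet s) :
    IsStarProjection (mulOp K ν (s.indicator 1)) := by
  refine ⟨?_, mulOp_isSelfAdjoint (.indicator_one hs) fun x => ?_⟩
  · rw [IsIdempotentElem, ← mulOp_inter_indicator hs hs, Set.inter_self]
  · by_cases hx : x ∈ s <;> simp [hx]

theorem enorm_sq_mulOp_indicator {s : Set X} (hs : MeasurableSet s) (f : Lp K 2 ν) :
    ‖mulOp K ν (s.indicator 1) f‖ₑ ^ 2 = sqMeasure f s := by
  rw [enorm_sq_eq_lintegral, sqMeasure, withDensity_apply _ hs, ← lintegral_indicator hs]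
  refine lintegral_congr_ae ?_
  filter_upwards [mulOp_coeFn (.indicator_one hs) f] with x hx
  rw [hx]
  by_cases h : x ∈ s <;> simp [h]

instance (f : Lp K 2 ν) : IsFiniteMeasure (sqMeasure f) := by
  refine isFiniteMeasure_withDensity ?_
  rw [← enorm_sq_eq_lintegral]
  simp

/-- Finite partial sums are multiplications by indicators of finite unions. The squared distance to
the limit is the mass that the finite measure `sqMeasure f` gives to the remaining sets, the tail of
a convergent series. -/
theorem hasSum_mulOp_indicator {s : ℕ → Set X} (hs : ∀ n, MeasurableSet (s n))
    (hd : Pairwise (Function.onFun Disjoint s)) (f : Lp K 2 ν) :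
    HasSum (fun n => mulOp K ν ((s n).indicator 1) f)
      (mulOp K ν ((⋃ n, s n).indicator 1) f) := by
  have hsum : ∀ F : Finset ℕ, ∑ n ∈ F, mulOp K ν ((s n).indicator 1) f =
      mulOp K ν ((⋃ n ∈ F, s n).indicator 1) f := by
    intro F
    induction F using Finset.induction_on with
    | empty =>
      have h : (⋃ n ∈ (∅ : Finset ℕ), s n).indicator (1 : X → ℂ) = 0 := by
        ext x
        simp
      rw [h, mulOp_zero, Finset.sum_empty, zero_apply]
    | insert a F ha ih =>
      rw [Finset.sum_insert ha, ih, Finset.set_biUnion_insert]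
      have hF : MeasurableSet (⋃ n ∈ F, s n) := F.measurableSet_biUnion fun n _ => hs n
      have h := mulOp_sub_indicator (K := K) (ν := ν) ((hs a).union hF) hF
        Set.subset_union_right
      have hdis : (s a ∪ ⋃ n ∈ F, s n) \ (⋃ n ∈ F, s n) = s a := by
        refine Set.union_sdiff_cancel_right ?_
        rw [Set.subset_empty_iff, ← Set.disjoint_iff_inter_eq_empty, Set.disjoint_iUnion₂_right]
        intro n hn
        exact hd fun h => ha (h ▸ hn)
      rw [hdis] at h
      rw [← h, sub_apply, sub_add_cancel]
  rw [HasSum, SummationFilter.unconditional_filter]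
  simp_rw [hsum]
  rw [tendsto_iff_edist_tendsto_0]
  have hU : MeasurableSet (⋃ n, s n) := .iUnion hs
  have key : ∀ F : Finset ℕ, edist (mulOp K ν ((⋃ n ∈ F, s n).indicator 1) f)
      (mulOp K ν ((⋃ n, s n).indicator 1) f) =
      (∑' n : {n // n ∉ F}, sqMeasure f (s n)) ^ (1 / 2 : ℝ) := by
    intro F
    have hF : MeasurableSet (⋃ n ∈ F, s n) := F.measurableSet_biUnion fun n _ => hs n
    rw [edist_comm, edist_eq_enorm_sub, ← sub_apply,
      mulOp_sub_indicator hU hF (Set.iUnion₂_subset_iUnion _ _)]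
    have h1 : ((⋃ n, s n) \ ⋃ n ∈ F, s n) = ⋃ n : {n // n ∉ F}, s n := by
      ext x
      simp only [Set.mem_sdiff, Set.mem_iUnion, Subtype.exists, exists_prop, not_exists, not_and]
      constructor
      · rintro ⟨⟨n, hn⟩, h⟩
        exact ⟨n, fun hF => h n hF hn, hn⟩
      · rintro ⟨n, hnF, hn⟩
        refine ⟨⟨n, hn⟩, fun k hk hx => ?_⟩
        exact (hd (show k ≠ n from fun h => hnF (h ▸ hk))).le_bot ⟨hx, hn⟩
    have h2 : Pairwise (Function.onFun Disjoint fun n : {n // n ∉ F} => s n) :=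
      fun i j hij => hd fun h => hij (Subtype.ext h)
    rw [h1, ← measure_iUnion h2 fun i => hs i,
      ← enorm_sq_mulOp_indicator (MeasurableSet.iUnion fun i : {n // n ∉ F} => hs i), ← ENNReal.rpow_natCast,
      ← ENNReal.rpow_mul]
    simp
  simp_rw [key]
  have h0 : Tendsto (fun F : Finset ℕ => ∑' n : {n // n ∉ F}, sqMeasure f (s n)) atTop (𝓝 0) := by
    refine ENNReal.tendsto_tsum_compl_atTop_zero (f := fun n => sqMeasure f (s n)) ?_
    rw [← measure_iUnion hd hs]
    exact measure_ne_top _ _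
  have h2 := h0.ennrpow_const (1 / 2 : ℝ)
  simpa using h2

end MulOp

/-! ### Unbounded self-adjoint operators. -/

section SelfAdjoint

variable {H : Type*} [NormedAddCommGroup H] [InnerProductSpace ℂ H] [CompleteSpace H]

/-- The basic criterion of self-adjointness: a symmetric operator for which `T - i` and `T + i` are
surjective is self-adjoint. -/
theorem isSelfAdjoint_of_isFormalAdjoint_of_surjective {T : H →ₗ.[ℂ] H}
    (hd : Dense (T.domain : Set H)) (hs : T.IsFormalAdjoint T)
    (hm : ∀ y, ∃ x : T.domain, T x - Complex.I • (x : H) = y)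
    (hp : ∀ y, ∃ x : T.domain, T x + Complex.I • (x : H) = y) : IsSelfAdjoint T := by
  rw [LinearPMap.isSelfAdjoint_def]
  have hle : T ≤ T.adjoint := hs.le_adjoint hd
  refine (LinearPMap.eq_of_le_of_domain_eq hle (le_antisymm hle.1 fun y hy => ?_)).symm
  -- For `y` in the domain of `T*`, take `x` in the domain of `T` with `(T - i) x = (T* - i) y`.
  -- Then `y - x` is orthogonal to the range of `T + i`, which is everything.
  obtain ⟨x, hx⟩ := hm (T.adjoint ⟨y, hy⟩ - Complex.I • y)
  have h1 : ∀ u : T.domain, ⟪y - x, T u + Complex.I • (u : H)⟫_ℂ = 0 := by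
    intro u
    have e1 : ⟪T.adjoint ⟨y, hy⟩, (u : H)⟫_ℂ = ⟪y, T u⟫_ℂ := LinearPMap.adjoint_isFormalAdjoint hd ⟨y, hy⟩ u
    have e2 : ⟪T x, (u : H)⟫_ℂ = ⟪(x : H), T u⟫_ℂ := hs x u
    have e3 : ⟪T x - Complex.I • (x : H), (u : H)⟫_ℂ =
      ⟪T.adjoint ⟨y, hy⟩ - Complex.I • y, (u : H)⟫_ℂ := by rw [hx]
    simp only [inner_sub_left, inner_smul_left, inner_add_right, inner_smul_right,
      Complex.conj_I] at e3 ⊢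
    rw [← e1, ← e2]
    linear_combination -e3
  obtain ⟨u, hu⟩ := hp (y - x)
  have h2 := h1 u
  rw [hu, inner_self_eq_zero, sub_eq_zero] at h2
  rw [h2]
  exact x.2

/-- A self-adjoint operator `T` such that `T - r`, with `r` real, is injective has a dense range of
`T - r`. -/
theorem denseRange_sub_of_isSelfAdjoint {T : H →ₗ.[ℂ] H} (hT : IsSelfAdjoint T) (r : ℝ)
    (hi : ∀ x : T.domain, T x = (r : ℂ) • (x : H) → x = 0) :
    DenseRange fun x : T.domain => T x - (r : ℂ) • (x : H) := by
  let L : T.domain →ₗ[ℂ] H := T.toFun - (r : ℂ) • T.domain.subtype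
  -- A vector orthogonal to the range of `T - r` lies in the domain of `T* = T` and satisfies `T y =
  -- r y`.
  have hL : (LinearMap.range L).topologicalClosure = ⊤ := by
    rw [Submodule.topologicalClosure_eq_top_iff, Submodule.eq_bot_iff]
    intro y hy
    rw [Submodule.mem_orthogonal'] at hy
    have h1 : ∀ u : T.domain, ⟪(r : ℂ) • y, (u : H)⟫_ℂ = ⟪y, T u⟫_ℂ := by
      intro u
      have h := hy (L u) ⟨u, rfl⟩
      have h' : ⟪y, T u - (r : ℂ) • (u : H)⟫_ℂ = 0 := h
      rw [inner_sub_right, inner_smul_right, sub_eq_zero] at h'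
      rw [h', inner_smul_left, Complex.conj_ofReal]
    have hy1 : y ∈ T.adjoint.domain := LinearPMap.mem_adjoint_domain_of_exists y ⟨_, h1⟩
    have h2 : T.adjoint ⟨y, hy1⟩ = (r : ℂ) • y := LinearPMap.adjoint_apply_eq hT.dense_domain _ h1
    -- Membership in the domain depends on the operator; quantifying over `S` allows substitution of
    -- `T.adjoint = T`.
    have key : ∀ S : H →ₗ.[ℂ] H, S = T → ∀ hS : y ∈ S.domain, S ⟨y, hS⟩ = (r : ℂ) • y → y = 0 := by
      rintro S rfl hS h
      exact congrArg Subtype.val (hi ⟨y, hS⟩ h)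
    exact key _ (LinearPMap.isSelfAdjoint_def.1 hT) hy1 h2
  have hd := (Submodule.dense_iff_topologicalClosure_eq_top).2 hL
  exact hd

end SelfAdjoint

/-! ### Unbounded multiplication operators: resolvent, spectrum and spectral measure. -/

section Mult

variable {X : Type*} [MeasurableSpace X] {K : Type*} [NormedAddCommGroup K]
  [InnerProductSpace ℂ K] {ν : Measure X}
  {H : Type*} [NormedAddCommGroup H] [InnerProductSpace ℂ H]

/-- The multiplication operator by `φ`, transported to `H`. -/
def conjMul (W : H ≃ₗᵢ[ℂ] Lp K 2 ν) (φ : X → ℂ) : H →L[ℂ] H :=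
  W.symm.toContinuousLinearEquiv.toContinuousLinearMap ∘L mulOp K ν φ ∘L
    W.toContinuousLinearEquiv.toContinuousLinearMap

theorem conjMul_apply (W : H ≃ₗᵢ[ℂ] Lp K 2 ν) (φ : X → ℂ) (x : H) :
    conjMul W φ x = W.symm (mulOp K ν φ (W x)) := rfl

/-- The domain of multiplication by the unbounded function `m`, transported to `H`. -/
def mulDomain (W : H ≃ₗᵢ[ℂ] Lp K 2 ν) (m : X → ℝ≥0) : Submodule ℂ H where
  carrier := {x | MemLp (fun s => (m s : ℂ) • W x s) 2 ν}
  zero_mem' := by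
    refine (MemLp.zero' : MemLp (fun _ : X => (0 : K)) 2 ν).ae_eq ?_
    rw [map_zero]
    filter_upwards [Lp.coeFn_zero K 2 ν] with s hs
    rw [hs, Pi.zero_apply, smul_zero]
  add_mem' := by
    intro x y hx hy
    refine (MemLp.add hx hy).ae_eq ?_
    rw [map_add]
    filter_upwards [Lp.coeFn_add (W x) (W y)] with s hs
    rw [hs, Pi.add_apply, Pi.add_apply, smul_add]
  smul_mem' := by
    intro c x hx
    refine (MemLp.const_smul hx c).ae_eq ?_
    rw [map_smul]
    filter_upwards [Lp.coeFn_smul c (W x)] with s hs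
    rw [hs, Pi.smul_apply, Pi.smul_apply, smul_comm]

theorem memLp_of_mem_mulDomain {W : H ≃ₗᵢ[ℂ] Lp K 2 ν} {m : X → ℝ≥0} (x : mulDomain W m) :
    MemLp (fun s => (m s : ℂ) • W (x : H) s) 2 ν := x.2

/-- The multiplication operator by the unbounded function `m`, transported to `H`. -/
def mulPMap (W : H ≃ₗᵢ[ℂ] Lp K 2 ν) (m : X → ℝ≥0) : H →ₗ.[ℂ] H where
  domain := mulDomain W m
  toFun :=
    { toFun x := W.symm ((memLp_of_mem_mulDomain x).toLp _)
      map_add' x y := by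
        refine (congrArg W.symm (Lp.ext ?_)).trans (W.symm.map_add _ _)
        filter_upwards [(memLp_of_mem_mulDomain (x + y)).coeFn_toLp,
          (memLp_of_mem_mulDomain x).coeFn_toLp, (memLp_of_mem_mulDomain y).coeFn_toLp,
          Lp.coeFn_add ((memLp_of_mem_mulDomain x).toLp _) ((memLp_of_mem_mulDomain y).toLp _),
          Lp.coeFn_add (W (x : H)) (W (y : H))] with s h1 h2 h3 h4 h5
        rw [h1, h4, Pi.add_apply, h2, h3, Submodule.coe_add, map_add, h5, Pi.add_apply, smul_add]
      map_smul' c x := by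
        refine (congrArg W.symm (Lp.ext ?_)).trans (W.symm.map_smul _ _)
        filter_upwards [(memLp_of_mem_mulDomain (c • x)).coeFn_toLp,
          (memLp_of_mem_mulDomain x).coeFn_toLp,
          Lp.coeFn_smul c ((memLp_of_mem_mulDomain x).toLp _),
          Lp.coeFn_smul c (W (x : H))] with s h1 h2 h3 h4
        rw [h1, RingHom.id_apply, h3, Pi.smul_apply, h2, Submodule.coe_smul, map_smul, h4,
          Pi.smul_apply, smul_comm] }

theorem mem_mulPMap_domain {W : H ≃ₗᵢ[ℂ] Lp K 2 ν} {m : X → ℝ≥0} {x : H} :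
    x ∈ (mulPMap W m).domain ↔ MemLp (fun s => (m s : ℂ) • W x s) 2 ν := Iff.rfl

theorem mulPMap_coeFn (W : H ≃ₗᵢ[ℂ] Lp K 2 ν) (m : X → ℝ≥0) (x : (mulPMap W m).domain) :
    W (mulPMap W m x) =ᵐ[ν] fun s => (m s : ℂ) • W (x : H) s := by
  have h : W (mulPMap W m x) =
      (memLp_of_mem_mulDomain x).toLp _ :=
    W.apply_symm_apply _
  rw [h]
  exact MemLp.coeFn_toLp _

/-- Used for `φ = (m - z)⁻¹`, where `m φ` stays bounded although `m` does not. -/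
theorem conjMul_mem_mulPMap_domain (W : H ≃ₗᵢ[ℂ] Lp K 2 ν) {m : X → ℝ≥0} {φ : X → ℂ}
    (h : BddMeas φ) (h' : BddMeas fun s => (m s : ℂ) * φ s) (x : H) :
    conjMul W φ x ∈ (mulPMap W m).domain := by
  rw [mem_mulPMap_domain, conjMul_apply, W.apply_symm_apply]
  refine (h'.memLp (W x)).ae_eq ?_
  filter_upwards [mulOp_coeFn h (W x)] with s hs
  rw [hs, mul_smul]

variable [CompleteSpace K] [CompleteSpace H]

theorem conjMul_isStarProjection (W : H ≃ₗᵢ[ℂ] Lp K 2 ν) {s : Set X} (hs : MeasurableSet s) :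
    IsStarProjection (conjMul W (s.indicator 1)) := by
  obtain ⟨h1, h2⟩ := mulOp_isStarProjection (K := K) (ν := ν) hs
  refine ⟨?_, ?_⟩
  · ext x
    rw [mul_apply_eq_comp, conjMul_apply, conjMul_apply, W.apply_symm_apply,
      ← mul_apply_eq_comp, h1.eq]
  · rw [ContinuousLinearMap.isSelfAdjoint_iff_isSymmetric] at h2 ⊢
    intro x y
    simp only [ContinuousLinearMap.coe_coe, conjMul_apply]
    rw [← W.inner_map_map, ← W.inner_map_map x, W.apply_symm_apply, W.apply_symm_apply]
    exact h2 _ _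

/-- The projection valued measure of multiplication by `m`. -/
def mulPVM (W : H ≃ₗᵢ[ℂ] Lp K 2 ν) {m : X → ℝ≥0} (hm : Measurable m) : ProjMeasure ℝ≥0 H where
  proj s := conjMul W ((m ⁻¹' s).indicator 1)
  isStarProjection s hs := conjMul_isStarProjection W (hm hs)
  proj_empty := by
    ext x
    rw [conjMul_apply, Set.preimage_empty, show (∅ : Set X).indicator (1 : X → ℂ) = 0 from
      Set.indicator_empty _, mulOp_zero]
    simp
  proj_univ := by
    ext x
    rw [conjMul_apply, Set.preimage_univ, Set.indicator_univ, mulOp_one]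
    simp
  proj_inter s t hs ht := by
    ext x
    rw [mul_apply_eq_comp, conjMul_apply, conjMul_apply, conjMul_apply, W.apply_symm_apply,
      Set.preimage_inter, mulOp_inter_indicator (hm hs) (hm ht), mul_apply_eq_comp]
  hasSum_proj s hs hd x := by
    rw [conjMul_apply, Set.preimage_iUnion]
    exact (hasSum_mulOp_indicator (fun n => hm (hs n))
      (fun i j hij => (hd hij).preimage m) (W x)).mapL
      W.symm.toContinuousLinearEquiv.toContinuousLinearMap

theorem mulPVM_proj (W : H ≃ₗᵢ[ℂ] Lp K 2 ν) {m : X → ℝ≥0} (hm : Measurable m) (s : Set ℝ≥0) :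
    (mulPVM W hm).proj s = conjMul W ((m ⁻¹' s).indicator 1) := rfl

/-- For an orthogonal projection `(x, P x) = ‖P x‖²`, here the integral of `‖W x‖²` over `m ⁻¹' s`.
Integrals against the scalar spectral measures thereby become integrals over `X`. -/
theorem mulPVM_scalar (W : H ≃ₗᵢ[ℂ] Lp K 2 ν) {m : X → ℝ≥0} (hm : Measurable m) (x : H) :
    (mulPVM W hm).scalar x = (sqMeasure (W x)).map m := by
  ext s hs
  rw [ProjMeasure.scalar_apply _ _ hs, Measure.map_apply hm hs,
    ← enorm_sq_mulOp_indicator (hm hs), mulPVM_proj]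
  have h := conjMul_isStarProjection W (hm hs)
  set P := conjMul W ((m ⁻¹' s).indicator 1)
  have h1 : ⟪x, P x⟫_ℂ = ⟪P x, P x⟫_ℂ := by
    conv_lhs => rw [← h.isIdempotentElem.eq, mul_apply_eq_comp]
    exact ((ContinuousLinearMap.isSelfAdjoint_iff_isSymmetric.1 h.isSelfAdjoint) x (P x)).symm
  have h2 : ‖mulOp K ν ((m ⁻¹' s).indicator 1) (W x)‖ = ‖P x‖ := by
    rw [← W.norm_map (P x)]
    simp only [P, conjMul_apply, W.apply_symm_apply]
  rw [h1, inner_self_eq_norm_sq_to_K, ← h2, ← ofReal_norm, ← ENNReal.ofReal_pow (by simp)]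
  norm_cast

theorem mulPMap_isFormalAdjoint (W : H ≃ₗᵢ[ℂ] Lp K 2 ν) (m : X → ℝ≥0) :
    (mulPMap W m).IsFormalAdjoint (mulPMap W m) := by
  intro x y
  rw [← W.inner_map_map, ← W.inner_map_map (x : H), L2.inner_def, L2.inner_def]
  refine integral_congr_ae ?_
  filter_upwards [mulPMap_coeFn W m x, mulPMap_coeFn W m y] with s h1 h2
  rw [h1, h2, inner_smul_left, inner_smul_right]
  simp

/-- If `z` is real it is negative and `δ = -Re z` works; otherwise `δ = |Im z|`. This bounds the
multiplier `(m - z)⁻¹`. -/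
theorem exists_le_norm_sub {z : ℂ} (hz : z ∉ ((↑) : ℝ → ℂ) '' Set.Ici 0) :
    ∃ δ > 0, ∀ r : ℝ≥0, δ ≤ ‖(r : ℂ) - z‖ := by
  by_cases h : z.im = 0
  · have hre : z.re < 0 := by
      by_contra! hre
      exact hz ⟨z.re, hre, Complex.ext rfl (by simp [h])⟩
    refine ⟨-z.re, by linarith, fun r => ?_⟩
    refine le_trans ?_ (Complex.abs_re_le_norm _)
    refine le_trans ?_ (le_abs_self _)
    simp
  · refine ⟨|z.im|, by positivity, fun r => ?_⟩
    refine le_trans ?_ (Complex.abs_im_le_norm _)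
    simp

theorem bddMeas_inv_sub {m : X → ℝ≥0} (hm : Measurable m) {z : ℂ}
    (hz : z ∉ ((↑) : ℝ → ℂ) '' Set.Ici 0) : BddMeas fun s => ((m s : ℂ) - z)⁻¹ := by
  obtain ⟨δ, hδ, h⟩ := exists_le_norm_sub hz
  refine ⟨by fun_prop, δ⁻¹, fun x => ?_⟩
  rw [norm_inv]
  exact inv_anti₀ hδ (h _)

theorem sub_ne_zero_of_notMem {z : ℂ} (hz : z ∉ ((↑) : ℝ → ℂ) '' Set.Ici 0) (r : ℝ≥0) :
    (r : ℂ) - z ≠ 0 := by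
  obtain ⟨δ, hδ, h⟩ := exists_le_norm_sub hz
  exact norm_pos_iff.1 (hδ.trans_le (h r))

/-- `m / (m - z) = 1 + z / (m - z)`, so the resolvent maps into the domain. -/
theorem bddMeas_mul_inv_sub {m : X → ℝ≥0} (hm : Measurable m) {z : ℂ}
    (hz : z ∉ ((↑) : ℝ → ℂ) '' Set.Ici 0) :
    BddMeas fun s => (m s : ℂ) * ((m s : ℂ) - z)⁻¹ := by
  obtain ⟨h1, C, hC⟩ := bddMeas_inv_sub hm hz
  refine ⟨by fun_prop, 1 + ‖z‖ * C, fun x => ?_⟩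
  have h : (m x : ℂ) * ((m x : ℂ) - z)⁻¹ = 1 + z * ((m x : ℂ) - z)⁻¹ := by
    have := sub_ne_zero_of_notMem hz (m x)
    field_simp
    ring
  refine (congrArg norm h).le.trans ((norm_add_le _ _).trans ?_)
  rw [norm_one, norm_mul]
  gcongr
  exact hC x

theorem mulPMap_resolvent_right (W : H ≃ₗᵢ[ℂ] Lp K 2 ν) {m : X → ℝ≥0} (hm : Measurable m) {z : ℂ}
    (hz : z ∉ ((↑) : ℝ → ℂ) '' Set.Ici 0) (y : H) :
    ∃ h : conjMul W (fun s => ((m s : ℂ) - z)⁻¹) y ∈ (mulPMap W m).domain,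
      mulPMap W m ⟨_, h⟩ - z • conjMul W (fun s => ((m s : ℂ) - z)⁻¹) y = y := by
  have hb := bddMeas_inv_sub hm hz
  have h := conjMul_mem_mulPMap_domain W hb (bddMeas_mul_inv_sub hm hz) y
  refine ⟨h, W.injective ?_⟩
  apply Lp.ext
  have h1 := mulPMap_coeFn W m ⟨_, h⟩
  simp only [conjMul_apply, W.apply_symm_apply] at h1
  simp only [map_sub, map_smul, conjMul_apply, W.apply_symm_apply]
  filter_upwards [h1, mulOp_coeFn hb (W y),
    Lp.coeFn_sub (W (mulPMap W m ⟨_, h⟩)) (z • mulOp K ν (fun s => ((m s : ℂ) - z)⁻¹) (W y)),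
    Lp.coeFn_smul z (mulOp K ν (fun s => ((m s : ℂ) - z)⁻¹) (W y))] with s h1 h2 h3 h4
  simp only [conjMul_apply] at h3
  rw [h3, Pi.sub_apply, h4, Pi.smul_apply, h1, h2, ← sub_smul, smul_smul,
    mul_inv_cancel₀ (sub_ne_zero_of_notMem hz _), one_smul]

theorem mulPMap_resolvent_left (W : H ≃ₗᵢ[ℂ] Lp K 2 ν) {m : X → ℝ≥0} (hm : Measurable m) {z : ℂ}
    (hz : z ∉ ((↑) : ℝ → ℂ) '' Set.Ici 0) (x : (mulPMap W m).domain) :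
    conjMul W (fun s => ((m s : ℂ) - z)⁻¹) (mulPMap W m x - z • (x : H)) = x := by
  have hb := bddMeas_inv_sub hm hz
  rw [conjMul_apply, LinearIsometryEquiv.symm_apply_eq, map_sub, map_smul]
  apply Lp.ext
  filter_upwards [mulPMap_coeFn W m x, mulOp_coeFn hb (W (mulPMap W m x) - z • W (x : H)),
    Lp.coeFn_sub (W (mulPMap W m x)) (z • W (x : H)), Lp.coeFn_smul z (W (x : H))]
    with s h1 h2 h3 h4
  rw [h2, h3, Pi.sub_apply, h4, Pi.smul_apply, h1, ← sub_smul, smul_smul,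
    inv_mul_cancel₀ (sub_ne_zero_of_notMem hz _), one_smul]

theorem inner_mulPMap (W : H ≃ₗᵢ[ℂ] Lp K 2 ν) (m : X → ℝ≥0) (x : (mulPMap W m).domain) :
    ⟪(x : H), mulPMap W m x⟫_ℂ = ((∫ s, (m s : ℝ) * ‖W (x : H) s‖ ^ 2 ∂ν : ℝ) : ℂ) := by
  rw [← W.inner_map_map, L2.inner_def, ← integral_complex_ofReal]
  refine integral_congr_ae ?_
  filter_upwards [mulPMap_coeFn W m x] with s h1
  rw [h1, inner_smul_right, inner_self_eq_norm_sq_to_K]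
  push_cast
  rfl

theorem mulPMap_nonneg (W : H ≃ₗᵢ[ℂ] Lp K 2 ν) (m : X → ℝ≥0) (x : (mulPMap W m).domain) :
    0 ≤ (⟪(x : H), mulPMap W m x⟫_ℂ).re := by
  rw [inner_mulPMap, Complex.ofReal_re]
  exact integral_nonneg fun s => by positivity

theorem notMem_ofReal_Ici_of_im_ne_zero {z : ℂ} (hz : z.im ≠ 0) :
    z ∉ ((↑) : ℝ → ℂ) '' Set.Ici 0 := by
  rintro ⟨r, -, rfl⟩
  simp at hz

/-- Write a vector `y` orthogonal to the domain as `(T + 1) R` with `R` in the domain. Then `0 = (R,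
T R) + ‖R‖²` with both terms non-negative, so `R = 0` and `y = 0`. -/
theorem mulPMap_dense_domain (W : H ≃ₗᵢ[ℂ] Lp K 2 ν) {m : X → ℝ≥0} (hm : Measurable m) :
    Dense ((mulPMap W m).domain : Set H) := by
  rw [Submodule.dense_iff_topologicalClosure_eq_top, Submodule.topologicalClosure_eq_top_iff,
    Submodule.eq_bot_iff]
  intro y hy
  rw [Submodule.mem_orthogonal] at hy
  have hz : (-1 : ℂ) ∉ ((↑) : ℝ → ℂ) '' Set.Ici 0 := by
    rintro ⟨r, hr, h⟩
    have := congrArg Complex.re h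
    simp only [Complex.ofReal_re, Complex.neg_re, Complex.one_re] at this
    rw [Set.mem_Ici] at hr
    linarith
  obtain ⟨h, h1⟩ := mulPMap_resolvent_right W hm hz y
  set R := conjMul W (fun s => ((m s : ℂ) - (-1))⁻¹) y
  have h4 : ⟪R, mulPMap W m ⟨R, h⟩⟫_ℂ + ⟪R, R⟫_ℂ = 0 := by
    rw [← hy R h, ← inner_add_right]
    congr 1
    rw [← h1, neg_one_smul, sub_neg_eq_add]
  have h5 := congrArg Complex.re h4
  have h6 := mulPMap_nonneg W m ⟨R, h⟩
  have h7 : R = 0 := by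
    have h8 : (⟪R, R⟫_ℂ).re = ‖R‖ ^ 2 := inner_self_eq_norm_sq (𝕜 := ℂ) R
    rw [Complex.add_re, h8, Complex.zero_re] at h5
    have h9 : ‖R‖ ^ 2 ≤ 0 := by
      have : 0 ≤ (⟪R, mulPMap W m ⟨R, h⟩⟫_ℂ).re := h6
      linarith
    exact norm_eq_zero.1 (pow_eq_zero_iff two_ne_zero |>.1 (le_antisymm h9 (by positivity)))
  have h10 : (⟨R, h⟩ : (mulPMap W m).domain) = 0 := Subtype.ext h7
  have h11 : mulPMap W m ⟨R, h⟩ - (-1 : ℂ) • R = y := h1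
  rw [← h11, h10, h7, LinearPMap.map_zero, smul_zero, sub_zero]

theorem mulPMap_isSelfAdjoint (W : H ≃ₗᵢ[ℂ] Lp K 2 ν) {m : X → ℝ≥0} (hm : Measurable m) :
    IsSelfAdjoint (mulPMap W m) := by
  refine isSelfAdjoint_of_isFormalAdjoint_of_surjective (mulPMap_dense_domain W hm)
    (mulPMap_isFormalAdjoint W m) (fun y => ?_) fun y => ?_
  · obtain ⟨h, h1⟩ := mulPMap_resolvent_right W hm
      (notMem_ofReal_Ici_of_im_ne_zero (z := Complex.I) (by simp)) y
    exact ⟨⟨_, h⟩, h1⟩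
  · obtain ⟨h, h1⟩ := mulPMap_resolvent_right W hm
      (notMem_ofReal_Ici_of_im_ne_zero (z := -Complex.I) (by simp)) y
    refine ⟨⟨_, h⟩, ?_⟩
    rwa [neg_smul, sub_neg_eq_add] at h1

theorem mulPMap_isSpectralMeasure (W : H ≃ₗᵢ[ℂ] Lp K 2 ν) {m : X → ℝ≥0} (hm : Measurable m) :
    IsSpectralMeasure (mulPVM W hm) (mulPMap W m) := by
  have haem (x : H) : AEMeasurable (fun s => ‖W x s‖ₑ ^ 2) ν :=
    (Lp.aestronglyMeasurable (W x)).enorm.pow_const 2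
  refine ⟨fun x => ?_, fun x => ?_⟩
  · rw [mulPVM_scalar, lintegral_map (by fun_prop) hm, sqMeasure,
      lintegral_withDensity_eq_lintegral_mul₀ (haem x) (by fun_prop), mem_mulPMap_domain, MemLp,
      and_iff_right, eLpNorm_lt_top_iff_lintegral_rpow_enorm_lt_top (by simp) (by simp)]
    · refine iff_of_eq (congrArg (· < ∞) (lintegral_congr fun s => ?_))
      rw [Pi.mul_apply, enorm_smul]
      simp only [ENNReal.toReal_ofNat, ENNReal.rpow_ofNat, mul_pow]
      rw [mul_comm]
      congr 2
      simp [enorm]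
    · have : Measurable fun s => (m s : ℂ) := by fun_prop
      exact this.aestronglyMeasurable.smul (Lp.aestronglyMeasurable (W x))
  · rw [mulPVM_scalar, integral_map hm.aemeasurable (by fun_prop), inner_mulPMap, sqMeasure,
      integral_withDensity_eq_integral_toReal_smul₀ (haem x)]
    · congr 1
      refine integral_congr_ae (Eventually.of_forall fun s => ?_)
      simp [mul_comm]
    · exact Eventually.of_forall fun s => by simp [lt_top_iff_ne_top]

/-- The eigenvalue equation forces `W x` to vanish where `m ≠ l`, which is almost everywhere. -/
theorem mulPMap_injective_sub (W : H ≃ₗᵢ[ℂ] Lp K 2 ν) {m : X → ℝ≥0} {l : ℝ≥0}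
    (hl : ν (m ⁻¹' {l}) = 0) (x : (mulPMap W m).domain)
    (hx : mulPMap W m x = (l : ℂ) • (x : H)) : x = 0 := by
  refine Subtype.ext (W.injective ?_)
  rw [Submodule.coe_zero, map_zero]
  apply Lp.ext
  have h0 := mulPMap_coeFn W m x
  rw [hx, map_smul] at h0
  have hae : ∀ᵐ s ∂ν, m s ≠ l := by
    rw [ae_iff]
    simp only [not_not]
    exact hl
  filter_upwards [h0, Lp.coeFn_smul (l : ℂ) (W (x : H)), Lp.coeFn_zero K 2 ν, hae]
    with s h1 h2 h3 h4
  rw [h2, Pi.smul_apply, ← sub_eq_zero, ← sub_smul, smul_eq_zero, sub_eq_zero] at h1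
  rw [h3, Pi.zero_apply]
  refine h1.resolve_left fun h => h4 ?_
  exact_mod_cast h.symm

/-- Indicator functions of sets where `|m - l| ≤ ε` are approximate eigenvectors: `‖(T - l) x‖ ≤ ε
‖x‖`. A bounded left inverse `R` would give `‖x‖ ≤ ‖R‖ ε ‖x‖`, which fails for `ε = 1 / (‖R‖ + 1)`.
-/
theorem mem_spectrumPMap_mulPMap [Nontrivial K] (W : H ≃ₗᵢ[ℂ] Lp K 2 ν) {m : X → ℝ≥0}
    (hm : Measurable m) {l : ℝ≥0}
    (hl : ∀ ε : ℝ, 0 < ε → ∃ s, MeasurableSet s ∧ ν s ≠ 0 ∧ ν s ≠ ∞ ∧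
      ∀ x ∈ s, |(m x : ℝ) - l| ≤ ε) :
    (l : ℂ) ∈ spectrumPMap (mulPMap W m) := by
  rintro ⟨R, -, hR⟩
  obtain ⟨k, hk⟩ := exists_ne (0 : K)
  obtain ⟨s, hs, hs0, hst, hsm⟩ := hl ((‖R‖ + 1)⁻¹) (by positivity)
  let f : Lp K 2 ν := indicatorConstLp 2 hs hst k
  have hf : f =ᵐ[ν] s.indicator fun _ => k := indicatorConstLp_coeFn
  have hf0 : f ≠ 0 := by
    rw [Ne, ← norm_eq_zero, norm_indicatorConstLp (by simp) (by simp)]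
    have : 0 < ν.real s := ENNReal.toReal_pos hs0 hst
    positivity
  obtain ⟨x, hx⟩ := W.surjective f
  set ε := (‖R‖ + 1)⁻¹ with hε
  have hxd : x ∈ (mulPMap W m).domain := by
    rw [mem_mulPMap_domain, hx]
    refine (Lp.memLp f).of_le_mul (c := l + ε) ?_ ?_
    · have : Measurable fun s => (m s : ℂ) := by fun_prop
      exact this.aestronglyMeasurable.smul (Lp.aestronglyMeasurable f)
    · filter_upwards [hf] with a ha
      rw [ha]
      by_cases has : a ∈ s
      · have := (abs_le.1 (hsm a has)).2
        rw [norm_smul, Complex.norm_real, Real.norm_of_nonneg (by positivity)]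
        gcongr
        linarith
      · simp [has]
  have h1 : ‖W (mulPMap W m ⟨x, hxd⟩ - (l : ℂ) • x)‖ ≤ ε * ‖f‖ := by
    rw [map_sub, map_smul]
    refine Lp.norm_le_mul_norm_of_ae_le_mul ?_
    filter_upwards [hf, mulPMap_coeFn W m ⟨x, hxd⟩,
      Lp.coeFn_sub (W (mulPMap W m ⟨x, hxd⟩)) ((l : ℂ) • W x), Lp.coeFn_smul (l : ℂ) (W x)]
      with a ha h1 h2 h3
    rw [h2, Pi.sub_apply, h1, h3, Pi.smul_apply, hx, ← sub_smul, ha, norm_smul]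
    by_cases has : a ∈ s
    · gcongr
      have : ((m a : ℂ) - (l : ℂ)) = ((m a - l : ℝ) : ℂ) := by push_cast; rfl
      rw [this, Complex.norm_real]
      exact hsm a has
    · simp [has]
  rw [W.norm_map] at h1
  have h2 : ‖f‖ = ‖R (mulPMap W m ⟨x, hxd⟩ - (l : ℂ) • x)‖ := by
    rw [hR ⟨x, hxd⟩, ← hx, W.norm_map]
  have h3 := (h2.le.trans (R.le_opNorm _)).trans (mul_le_mul_of_nonneg_left h1 (norm_nonneg R))
  have h4 : 0 < ‖f‖ := norm_pos_iff.2 hf0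
  have h5 : ‖R‖ * ε < 1 := by
    rw [hε, ← div_eq_mul_inv, div_lt_one (by positivity)]
    linarith
  nlinarith

theorem spectrumPMap_mulPMap [Nontrivial K] (W : H ≃ₗᵢ[ℂ] Lp K 2 ν) {m : X → ℝ≥0}
    (hm : Measurable m)
    (hl : ∀ l : ℝ≥0, ∀ ε : ℝ, 0 < ε → ∃ s, MeasurableSet s ∧ ν s ≠ 0 ∧ ν s ≠ ∞ ∧
      ∀ x ∈ s, |(m x : ℝ) - l| ≤ ε) :
    spectrumPMap (mulPMap W m) = ((↑) : ℝ → ℂ) '' Set.Ici 0 := by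
  refine Set.Subset.antisymm (fun z hz => ?_) ?_
  · by_contra h
    exact hz ⟨_, mulPMap_resolvent_right W hm h, mulPMap_resolvent_left W hm h⟩
  · rintro _ ⟨r, hr, rfl⟩
    exact mem_spectrumPMap_mulPMap W hm (hl ⟨r, hr⟩)

theorem contSpectrumPMap_mulPMap [Nontrivial K] (W : H ≃ₗᵢ[ℂ] Lp K 2 ν) {m : X → ℝ≥0}
    (hm : Measurable m)
    (hl : ∀ l : ℝ≥0, ∀ ε : ℝ, 0 < ε → ∃ s, MeasurableSet s ∧ ν s ≠ 0 ∧ ν s ≠ ∞ ∧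
      ∀ x ∈ s, |(m x : ℝ) - l| ≤ ε) (hn : ∀ l, ν (m ⁻¹' {l}) = 0) :
    contSpectrumPMap (mulPMap W m) = spectrumPMap (mulPMap W m) := by
  refine Set.Subset.antisymm (fun z hz => hz.1) fun z hz => ⟨hz, ?_⟩
  rw [spectrumPMap_mulPMap W hm hl] at hz
  obtain ⟨r, hr, rfl⟩ := hz
  have hi := mulPMap_injective_sub W (hn ⟨r, hr⟩)
  exact ⟨hi, denseRange_sub_of_isSelfAdjoint (mulPMap_isSelfAdjoint W hm) r hi⟩

end Mult

/-! ### The Fourier transform on `L²(ℝ; K)`. -/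

section FourierL2

open FourierTransform SchwartzMap
open scoped Real ContDiff

variable {K : Type*} [NormedAddCommGroup K] [InnerProductSpace ℂ K] [CompleteSpace K]

theorem continuous_fourier_of_integrable {f : ℝ → K} (hf : Integrable f) : Continuous (𝓕 f) :=
  VectorFourier.fourierIntegral_continuous Real.continuous_fourierChar
    (by exact continuous_inner) hf

theorem integral_fourier_smul_eq_of_integrable {g : ℝ → ℂ} {f : ℝ → K} (hg : Integrable g)
    (hf : Integrable f) : ∫ ξ, 𝓕 g ξ • f ξ = ∫ x, g x • 𝓕 f x := by
  have h := VectorFourier.integral_fourierIntegral_smul_eq_flip (L := innerₗ ℝ)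
    Real.continuous_fourierChar continuous_inner hg hf
  rw [flip_innerₗ] at h
  exact h

/-- The `L²` Fourier transform of an integrable function is given by the Fourier integral. -/
theorem fourier_toLp_ae {f : ℝ → K} (h1 : Integrable f) (h2 : MemLp f 2 volume) :
    (𝓕 (h2.toLp f) : Lp K 2 (volume : Measure ℝ)) =ᵐ[volume] 𝓕 f := by
  -- Both sides are locally integrable, so it suffices to test with smooth compactly supported
  -- functions. There the `L²` transform is the transform of tempered distributions, and it passes
  -- to the test function.
  apply ae_eq_of_integral_contDiff_smul_eq
  · exact (Lp.memLp _).locallyIntegrable one_le_two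
  · exact (continuous_fourier_of_integrable h1).locallyIntegrable
  intro g g_smooth g_cpt
  have hg₁ : HasCompactSupport (Complex.ofRealCLM ∘ g) := g_cpt.comp_left rfl
  have hg₂ : ContDiff ℝ ∞ (Complex.ofRealCLM ∘ g) := by fun_prop
  set φ : 𝓢(ℝ, ℂ) := hg₁.toSchwartzMap hg₂
  have e1 : ∫ x, g x • (𝓕 (h2.toLp f) : Lp K 2 (volume : Measure ℝ)) x =
      ((𝓕 (h2.toLp f) : Lp K 2 (volume : Measure ℝ)) : 𝓢'(ℝ, K)) φ := by
    simp [φ]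
  rw [e1, ← Lp.fourier_toTemperedDistribution_eq, TemperedDistribution.fourier_apply,
    Lp.toTemperedDistribution_apply]
  have e2 : ∫ x, (𝓕 φ : 𝓢(ℝ, ℂ)) x • (h2.toLp f) x = ∫ x, (𝓕 (φ : ℝ → ℂ)) x • f x := by
    refine integral_congr_ae ?_
    filter_upwards [h2.coeFn_toLp] with x hx
    rw [hx, SchwartzMap.fourier_coe]
  rw [e2, integral_fourier_smul_eq_of_integrable φ.integrable h1]
  simp [φ]

/-- The inverse `L²` Fourier transform of an integrable function is given by the integral. -/
theorem fourierInv_toLp_ae {f : ℝ → K} (h1 : Integrable f) (h2 : MemLp f 2 volume) :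
    (𝓕⁻ (h2.toLp f) : Lp K 2 (volume : Measure ℝ)) =ᵐ[volume] 𝓕⁻ f := by
  have hcont : Continuous (𝓕⁻ f) := by
    rw [Real.fourierInv_eq_fourier_comp_neg]
    exact continuous_fourier_of_integrable h1.comp_neg
  apply ae_eq_of_integral_contDiff_smul_eq
  · exact (Lp.memLp _).locallyIntegrable one_le_two
  · exact hcont.locallyIntegrable
  intro g g_smooth g_cpt
  have hg₁ : HasCompactSupport (Complex.ofRealCLM ∘ g) := g_cpt.comp_left rfl
  have hg₂ : ContDiff ℝ ∞ (Complex.ofRealCLM ∘ g) := by fun_prop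
  set φ : 𝓢(ℝ, ℂ) := hg₁.toSchwartzMap hg₂
  have e1 : ∫ x, g x • (𝓕⁻ (h2.toLp f) : Lp K 2 (volume : Measure ℝ)) x =
      ((𝓕⁻ (h2.toLp f) : Lp K 2 (volume : Measure ℝ)) : 𝓢'(ℝ, K)) φ := by
    simp [φ]
  rw [e1, ← Lp.fourierInv_toTemperedDistribution_eq, TemperedDistribution.fourierInv_apply,
    Lp.toTemperedDistribution_apply]
  have e2 : ∫ x, (𝓕⁻ φ : 𝓢(ℝ, ℂ)) x • (h2.toLp f) x = ∫ x, (𝓕 (φ : ℝ → ℂ)) x • f (-x) := by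
    rw [← integral_neg_eq_self]
    refine integral_congr_ae ?_
    filter_upwards [(Measure.measurePreserving_neg volume).quasiMeasurePreserving.ae h2.coeFn_toLp]
      with x hx
    rw [hx, SchwartzMap.fourierInv_coe, Real.fourierInv_eq_fourier_neg, neg_neg]
  rw [e2, integral_fourier_smul_eq_of_integrable φ.integrable h1.comp_neg,
    Real.fourierInv_eq_fourier_comp_neg]
  simp [φ]

variable (K) in
/-- The translation `f ↦ f(· + τ)` on `L²(ℝ; K)`. -/
def shiftL2 (τ : ℝ) : L2Line K →ₗᵢ[ℂ] L2Line K :=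
  Lp.compMeasurePreservingₗᵢ ℂ (fun s : ℝ => s + τ) (measurePreserving_add_right volume τ)

theorem shiftL2_coeFn (τ : ℝ) (f : L2Line K) :
    shiftL2 K τ f =ᵐ[volume] fun s => f (s + τ) :=
  Lp.coeFn_compMeasurePreserving f (measurePreserving_add_right volume τ)

/-- The transform has the kernel `e^{-2πivs}`, so the phase `e^{-iσt}` shifts the frequency by `t /
2π`; hence the factor `2π` in `energyTime`. -/
theorem fourier_exp_smul (t s : ℝ) (f : ℝ → K) :
    𝓕 (fun σ : ℝ => Complex.exp (-(Complex.I * σ * t)) • f σ) s = 𝓕 f (s + t / (2 * π)) := by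
  rw [Real.fourier_eq', Real.fourier_eq']
  congr 1
  ext v
  rw [smul_smul, ← Complex.exp_add]
  congr 2
  simp
  have : (π : ℂ) ≠ 0 := by exact_mod_cast Real.pi_ne_zero
  field_simp
  ring

/-- The Fourier transform turns the evolution `u(t)` into a translation. -/
theorem fourier_evol (t : ℝ) (f : L2Line K) :
    𝓕 (evol K t f) = shiftL2 K (t / (2 * π)) (𝓕 f) := by
  -- Both sides are continuous in `f`, and on the dense set of Schwartz functions the transforms are
  -- integrals.
  refine DenseRange.induction_on
    (p := fun f : L2Line K => 𝓕 (evol K t f) = shiftL2 K (t / (2 * π)) (𝓕 f))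
    (SchwartzMap.denseRange_toLpCLM (p := 2) ENNReal.ofNat_ne_top) f ?_ ?_
  · refine isClosed_eq ?_ ?_
    · exact (Lp.fourierTransformₗᵢ ℝ K).continuous.comp (evol K t).continuous
    · exact (shiftL2 K _).continuous.comp (Lp.fourierTransformₗᵢ ℝ K).continuous
  · intro φ
    have hφ : MemLp φ 2 volume := φ.memLp 2 volume
    set f : L2Line K := φ.toLp 2 with hf
    have hfφ : f =ᵐ[volume] φ := φ.coeFn_toLp 2 volume
    have hfφ' : hφ.toLp φ = f := Lp.ext (hφ.coeFn_toLp.trans hfφ.symm)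
    have hm : MemLp (fun σ : ℝ => Complex.exp (-(Complex.I * σ * t)) • φ σ) 2 volume := by
      refine (memLp_phase K t f).ae_eq ?_
      filter_upwards [hfφ] with x hx
      rw [hx]
    have hi : Integrable (fun σ : ℝ => Complex.exp (-(Complex.I * σ * t)) • φ σ) := by
      have hc : Continuous fun σ : ℝ => Complex.exp (-(Complex.I * σ * t)) := by fun_prop
      refine φ.integrable.mono (hc.aestronglyMeasurable.smul φ.continuous.aestronglyMeasurable)
        (Eventually.of_forall fun σ => ?_)
      rw [norm_smul, Complex.norm_exp]
      simp
    have hev : evol K t f = hm.toLp _ := by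
      apply Lp.ext
      filter_upwards [evol_coeFn K t f, hm.coeFn_toLp, hfφ] with x h1 h2 h3
      rw [h1, h2, h3]
    change 𝓕 (evol K t f) = shiftL2 K (t / (2 * π)) (𝓕 f)
    apply Lp.ext
    have h4 := fourier_toLp_ae φ.integrable hφ
    rw [hfφ'] at h4
    rw [hev]
    filter_upwards [fourier_toLp_ae hi hm, shiftL2_coeFn (t / (2 * π)) (𝓕 f),
      (measurePreserving_add_right volume (t / (2 * π))).quasiMeasurePreserving.ae h4]
      with s h1 h2 h3
    rw [h1, h2, h3, fourier_exp_smul]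

end FourierL2

/-! ### The Cauchy kernel and its Fourier transform. -/

section Cauchy

open FourierTransform
open scoped Real ComplexConjugate

variable {K : Type*} [NormedAddCommGroup K] [InnerProductSpace ℂ K]

theorem norm_sq_inv_ofReal_sub (w : ℂ) (x : ℝ) :
    ‖((x : ℂ) - w)⁻¹‖ ^ 2 = ((x - w.re) ^ 2 + w.im ^ 2)⁻¹ := by
  rw [norm_inv, inv_pow, Complex.sq_norm, Complex.normSq_apply]
  simp
  ring

theorem ofReal_sub_ne_zero {w : ℂ} (hw : w.im ≠ 0) (x : ℝ) : (x : ℂ) - w ≠ 0 := by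
  intro h
  apply hw
  have := congrArg Complex.im h
  simpa using this

theorem continuous_inv_ofReal_sub {w : ℂ} (hw : w.im ≠ 0) :
    Continuous fun x : ℝ => ((x : ℂ) - w)⁻¹ :=
  Continuous.inv₀ (by fun_prop) (ofReal_sub_ne_zero hw)

theorem inv_sq_add_sq_eq {b : ℝ} (hb : b ≠ 0) (x : ℝ) :
    (x ^ 2 + b ^ 2)⁻¹ = (b ^ 2)⁻¹ * (1 + (x / b) ^ 2)⁻¹ := by
  rw [← mul_inv]
  congr 1
  field_simp
  ring

theorem integrable_norm_sq_inv_ofReal_sub {w : ℂ} (hw : w.im ≠ 0) :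
    Integrable fun x : ℝ => ‖((x : ℂ) - w)⁻¹‖ ^ 2 := by
  simp_rw [norm_sq_inv_ofReal_sub, inv_sq_add_sq_eq hw]
  exact ((integrable_inv_one_add_sq.comp_div hw).comp_sub_right w.re).const_mul _

theorem integral_norm_sq_inv_ofReal_sub {w : ℂ} (hw : w.im ≠ 0) :
    ∫ x : ℝ, ‖((x : ℂ) - w)⁻¹‖ ^ 2 = π / |w.im| := by
  simp_rw [norm_sq_inv_ofReal_sub, inv_sq_add_sq_eq hw]
  rw [integral_sub_right_eq_self (fun x : ℝ => (w.im ^ 2)⁻¹ * (1 + (x / w.im) ^ 2)⁻¹) w.re,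
    integral_const_mul, Measure.integral_comp_div (fun x : ℝ => (1 + x ^ 2)⁻¹),
    integral_univ_inv_one_add_sq, smul_eq_mul, ← sq_abs w.im]
  have : |w.im| ≠ 0 := by simpa using hw
  field_simp

theorem lintegral_enorm_sq_inv_ofReal_sub {w : ℂ} (hw : w.im ≠ 0) :
    ∫⁻ x : ℝ, ‖((x : ℂ) - w)⁻¹‖ₑ ^ 2 = ENNReal.ofReal (π / |w.im|) := by
  rw [← integral_norm_sq_inv_ofReal_sub hw,
    ofReal_integral_eq_lintegral_ofReal (integrable_norm_sq_inv_ofReal_sub hw)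
      (Eventually.of_forall fun x => by positivity)]
  refine lintegral_congr fun x => ?_
  rw [ENNReal.ofReal_pow (norm_nonneg _), ofReal_norm]

theorem memLp_inv_ofReal_sub {w : ℂ} (hw : w.im ≠ 0) :
    MemLp (fun x : ℝ => ((x : ℂ) - w)⁻¹) 2 volume :=
  (memLp_two_iff_integrable_sq_norm
    (continuous_inv_ofReal_sub hw).aestronglyMeasurable).2 (integrable_norm_sq_inv_ofReal_sub hw)

theorem memLp_two_smul_const {φ : ℝ → ℂ} (h : MemLp φ 2 volume) (k : K) :
    MemLp (fun x => φ x • k) 2 volume :=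
  h.of_le_mul (c := ‖k‖) (h.1.smul_const k)
    (Eventually.of_forall fun x => by rw [norm_smul, mul_comm])

theorem integrable_smul_of_memLp_two {φ : ℝ → ℂ} {f : ℝ → K} (hφ : MemLp φ 2 volume)
    (hf : MemLp f 2 volume) : Integrable fun x => φ x • f x :=
  memLp_one_iff_integrable.1 (hf.smul (r := 1) hφ)

/-- The half-line where `s ↦ exp (-2πivs)` decays. -/
def decaySet (v : ℂ) : Set ℝ := {s | s * v.im < 0}

theorem measurableSet_decaySet (v : ℂ) : MeasurableSet (decaySet v) :=
  measurableSet_lt (by fun_prop) (by fun_prop)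

theorem decaySet_of_neg {v : ℂ} (hv : v.im < 0) : decaySet v = Set.Ioi 0 := by
  ext s
  simp only [decaySet, Set.mem_ofPred_eq, Set.mem_Ioi]
  constructor <;> intro h <;> nlinarith

theorem decaySet_of_pos {v : ℂ} (hv : 0 < v.im) : decaySet v = Set.Iio 0 := by
  ext s
  simp only [decaySet, Set.mem_ofPred_eq, Set.mem_Iio]
  constructor <;> intro h <;> nlinarith

/-- The function `exp (-2πivs)` on the half-line where it decays. -/
def halfExp (v : ℂ) : ℝ → ℂ :=
  (decaySet v).indicator fun s => Complex.exp (-(2 * π * Complex.I * v) * s)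

theorem norm_halfExp_le (v : ℂ) (s : ℝ) : ‖halfExp v s‖ ≤ 1 := by
  rw [halfExp]
  by_cases hs : s ∈ decaySet v
  · rw [Set.indicator_of_mem hs, Complex.norm_exp]
    simp only [decaySet, Set.mem_ofPred_eq] at hs
    rw [Real.exp_le_one_iff]
    simp
    nlinarith [Real.pi_pos]
  · simp [hs]

theorem integrable_halfExp {v : ℂ} (hv : v.im ≠ 0) : Integrable (halfExp v) := by
  rw [halfExp, integrable_indicator_iff (measurableSet_decaySet v)]
  rcases lt_or_gt_of_ne hv with h | h
  · rw [decaySet_of_neg h]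
    refine integrableOn_exp_mul_complex_Ioi ?_ 0
    simp
    nlinarith [Real.pi_pos]
  · rw [decaySet_of_pos h]
    refine (integrableOn_exp_mul_complex_Iic ?_ 0).mono_set Set.Iio_subset_Iic_self
    simp
    positivity

theorem memLp_halfExp {v : ℂ} (hv : v.im ≠ 0) : MemLp (halfExp v) 2 volume := by
  have h := integrable_halfExp hv
  rw [memLp_two_iff_integrable_sq_norm h.1]
  refine h.norm.mono (h.1.norm.pow 2) (Eventually.of_forall fun s => ?_)
  rw [norm_pow, norm_norm, sq]
  exact mul_le_of_le_one_right (norm_nonneg _) (norm_halfExp_le v s)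

/-- The constant of the Fourier transform of the Cauchy kernel. -/
def cauchyConst (v : ℂ) : ℂ := if v.im < 0 then -(2 * π * Complex.I)⁻¹ else (2 * π * Complex.I)⁻¹

theorem cauchyConst_ne_zero (v : ℂ) : cauchyConst v ≠ 0 := by
  have : (2 * π * Complex.I : ℂ) ≠ 0 := by simp [Real.pi_ne_zero]
  unfold cauchyConst
  split_ifs
  · exact neg_ne_zero.2 (inv_ne_zero this)
  · exact inv_ne_zero this

/-- An exponential is integrated over the half-line where it decays. The sign in `cauchyConst`
records whether `0` is the lower or the upper end point. -/
theorem fourierInv_halfExp_smul [CompleteSpace K] {v : ℂ} (hv : v.im ≠ 0) (k : K) (x : ℝ) :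
    𝓕⁻ (fun s => halfExp v s • k) x = (cauchyConst v * ((x : ℂ) - v)⁻¹) • k := by
  have hI : (2 * π * Complex.I : ℂ) ≠ 0 := by simp [Real.pi_ne_zero]
  have hx := ofReal_sub_ne_zero hv x
  rw [Real.fourierInv_eq']
  simp_rw [smul_smul]
  rw [integral_smul_const]
  congr 1
  have h1 : ∀ s : ℝ, Complex.exp (↑(2 * π * ⟪s, x⟫_ℝ) * Complex.I) * halfExp v s =
      (decaySet v).indicator (fun s : ℝ =>
        Complex.exp ((2 * π * Complex.I * ((x : ℂ) - v)) * s)) s := by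
    intro s
    by_cases hs : s ∈ decaySet v
    · rw [halfExp, Set.indicator_of_mem hs, Set.indicator_of_mem hs, ← Complex.exp_add]
      congr 1
      simp
      ring
    · simp [halfExp, hs]
  simp_rw [h1]
  rw [integral_indicator (measurableSet_decaySet v), cauchyConst]
  rcases lt_or_gt_of_ne hv with h | h
  · rw [decaySet_of_neg h, if_pos h, integral_exp_mul_complex_Ioi]
    · simp
      field_simp
      rw [Complex.I_sq]
    · simp
      nlinarith [Real.pi_pos]
  · rw [decaySet_of_pos h, if_neg h.not_gt, ← integral_Iic_eq_integral_Iio,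
      integral_exp_mul_complex_Iic]
    · simp
      field_simp
    · simp
      positivity

/-- The Cauchy transform of a square integrable function in terms of its Fourier transform. -/
theorem integral_inv_sub_smul_eq [CompleteSpace K] {v : ℂ} (hv : v.im ≠ 0) (f : L2Line K) :
    ∫ x : ℝ, ((x : ℂ) - conj v)⁻¹ • f x =
      (conj (cauchyConst v))⁻¹ • ∫ s : ℝ, conj (halfExp v s) • (𝓕 f : L2Line K) s := by
  have hv' : (conj v).im ≠ 0 := by simpa using hv
  have hE : MemLp (fun s => conj (halfExp v s)) 2 volume :=
    (memLp_halfExp hv).star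
  -- Paired with a vector `k`, both integrals are inner products in `L²`, with the Cauchy kernel `c`
  -- and with `e`. As `c` is a multiple of `𝓕⁻ e`, Plancherel's theorem connects them.
  refine ext_inner_left ℂ fun k => ?_
  set e : L2Line K := (memLp_two_smul_const (memLp_halfExp hv) k).toLp _ with he
  set c : L2Line K := (memLp_two_smul_const (memLp_inv_ofReal_sub hv) k).toLp _ with hc
  have hce : cauchyConst v • c = 𝓕⁻ e := by
    apply Lp.ext
    filter_upwards [fourierInv_toLp_ae ((integrable_halfExp hv).smul_const k)
      (memLp_two_smul_const (memLp_halfExp hv) k), Lp.coeFn_smul (cauchyConst v) c,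
      (memLp_two_smul_const (memLp_inv_ofReal_sub hv) k).coeFn_toLp] with x h1 h2 h3
    rw [h1, h2, Pi.smul_apply, h3, fourierInv_halfExp_smul hv, smul_smul]
  have h1 : ⟪k, ∫ x : ℝ, ((x : ℂ) - conj v)⁻¹ • f x⟫_ℂ = ⟪c, f⟫_ℂ := by
    rw [← integral_inner (integrable_smul_of_memLp_two (memLp_inv_ofReal_sub hv') (Lp.memLp f)),
      L2.inner_def]
    refine integral_congr_ae ?_
    filter_upwards [(memLp_two_smul_const (memLp_inv_ofReal_sub hv) k).coeFn_toLp] with x h1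
    rw [h1, inner_smul_left, inner_smul_right]
    simp
  have h2 : ⟪k, ∫ s : ℝ, conj (halfExp v s) • (𝓕 f : L2Line K) s⟫_ℂ =
      ⟪e, (𝓕 f : L2Line K)⟫_ℂ := by
    rw [← integral_inner (integrable_smul_of_memLp_two hE (Lp.memLp _)), L2.inner_def]
    refine integral_congr_ae ?_
    filter_upwards [(memLp_two_smul_const (memLp_halfExp hv) k).coeFn_toLp] with x h1
    rw [h1, inner_smul_left, inner_smul_right]
  have h3 : ⟪e, (𝓕 f : L2Line K)⟫_ℂ = ⟪𝓕⁻ e, f⟫_ℂ := by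
    rw [← Lp.inner_fourier_eq (𝓕⁻ e) f, FourierInvPair.fourier_fourierInv_eq]
  rw [h1, inner_smul_right, h2, h3, ← hce, inner_smul_left, inv_mul_cancel_left₀]
  simpa using cauchyConst_ne_zero v

/-- If the Cauchy transform of `f` vanishes on a line, then the Fourier transform of `f` vanishes on
a half-line. -/
theorem fourier_ae_eq_zero_of_cauchy [CompleteSpace K] {f : L2Line K} {b : ℝ} (hb : b ≠ 0)
    (h : ∀ v : ℂ, v.im = b → ∫ x : ℝ, ((x : ℂ) - conj v)⁻¹ • f x = 0) :
    ∀ᵐ s : ℝ, s * b < 0 → (𝓕 f : L2Line K) s = 0 := by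
  set v₀ : ℂ := b * Complex.I with hv₀
  have hv₀b : v₀.im = b := by simp [hv₀]
  have hv₀' : v₀.im ≠ 0 := by rwa [hv₀b]
  have hE : MemLp (fun s => conj (halfExp v₀ s)) 2 volume := (memLp_halfExp hv₀').star
  set p : ℝ → K := fun s => conj (halfExp v₀ s) • (𝓕 f : L2Line K) s with hp
  have hp1 : Integrable p := integrable_smul_of_memLp_two hE (Lp.memLp _)
  have hp2 : MemLp p 2 volume := by
    refine (Lp.memLp (𝓕 f : L2Line K)).of_le (hE.1.smul (Lp.aestronglyMeasurable _))
      (Eventually.of_forall fun s => ?_)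
    rw [norm_smul, RCLike.norm_conj]
    exact mul_le_of_le_one_left (norm_nonneg _) (norm_halfExp_le _ _)
  -- Replacing `v₀` by `v₀ + ξ` multiplies the conjugate of `halfExp` by the phase `e^{2πiξs}`.
  -- Along the line the Cauchy transform is thus a non-zero constant times the inverse Fourier
  -- transform of `p`.
  have h0 : ∀ ξ : ℝ, 𝓕⁻ p ξ = 0 := by
    intro ξ
    set v : ℂ := v₀ + ξ with hv
    have hvb : v.im = b := by simp [hv, hv₀b]
    have h1 := h v hvb
    rw [integral_inv_sub_smul_eq (by rwa [hvb]), smul_eq_zero] at h1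
    have h2 := h1.resolve_left (inv_ne_zero (by simpa using cauchyConst_ne_zero v))
    rw [Real.fourierInv_eq', ← h2]
    congr 1
    ext s
    rw [hp, smul_smul]
    congr 1
    have hset : decaySet v = decaySet v₀ := by simp [decaySet, hvb, hv₀b]
    rw [halfExp, halfExp, hset]
    by_cases hs : s ∈ decaySet v₀
    · rw [Set.indicator_of_mem hs, Set.indicator_of_mem hs, ← Complex.exp_conj, ← Complex.exp_conj,
        ← Complex.exp_add]
      congr 1
      simp [hv, Complex.conj_ofNat]
      ring
    · simp [hs]
  have h3 : hp2.toLp p = 0 := by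
    have h4 : (𝓕⁻ (hp2.toLp p) : L2Line K) = 0 := by
      apply Lp.ext
      filter_upwards [fourierInv_toLp_ae hp1 hp2, Lp.coeFn_zero K 2 (volume : Measure ℝ)]
        with ξ h1 h2
      rw [h1, h2, h0, Pi.zero_apply]
    exact (Lp.fourierTransformₗᵢ ℝ K).symm.map_eq_zero_iff.1 h4
  have h5 := hp2.coeFn_toLp
  rw [h3] at h5
  filter_upwards [h5, Lp.coeFn_zero K 2 (volume : Measure ℝ)] with s h6 h7 hs
  rw [h7, Pi.zero_apply] at h6
  have h8 := smul_eq_zero.1 h6.symm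
  refine h8.resolve_left ?_
  have hs' : s ∈ decaySet v₀ := by simpa [decaySet, hv₀b] using hs
  simp [halfExp, hs']

/-- If the Fourier transform of `f` vanishes on a half-line, then the Cauchy transform of `f`
vanishes on a half-plane. -/
theorem cauchy_eq_zero_of_fourier [CompleteSpace K] {f : L2Line K} {v : ℂ} (hv : v.im ≠ 0)
    (h : ∀ᵐ s : ℝ, s * v.im < 0 → (𝓕 f : L2Line K) s = 0) :
    ∫ x : ℝ, ((x : ℂ) - conj v)⁻¹ • f x = 0 := by
  rw [integral_inv_sub_smul_eq hv, integral_eq_zero_of_ae, smul_zero]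
  filter_upwards [h] with s hs
  by_cases h1 : s ∈ decaySet v
  · rw [hs h1, smul_zero, Pi.zero_apply]
  · simp [halfExp, h1]

end Cauchy

/-! ### Weak convergence of bounded sequences in `L²`. -/

section WeakConvergence

variable {X : Type*} [MeasurableSpace X] {ν : Measure X} {K : Type*} [NormedAddCommGroup K]

theorem eLpNorm_two_sq (f : X → K) : eLpNorm f 2 ν ^ 2 = ∫⁻ x, ‖f x‖ₑ ^ 2 ∂ν := by
  rw [eLpNorm_eq_lintegral_rpow_enorm_toReal (by simp) (by simp), ← ENNReal.rpow_natCast,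
    ← ENNReal.rpow_mul]
  simp

theorem lintegral_mul_enorm_le {φ : X → ℂ} {u : X → K} (hφ : AEStronglyMeasurable φ ν)
    (hu : AEStronglyMeasurable u ν) :
    ∫⁻ x, ‖φ x‖ₑ * ‖u x‖ₑ ∂ν ≤ eLpNorm φ 2 ν * eLpNorm u 2 ν := by
  have h := ENNReal.lintegral_mul_le_Lp_mul_Lq ν Real.HolderConjugate.two_two hφ.enorm hu.enorm
  rw [eLpNorm_eq_lintegral_rpow_enorm_toReal (by simp) (by simp),
    eLpNorm_eq_lintegral_rpow_enorm_toReal (by simp) (by simp)]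
  simpa using h

/-- A bounded sequence in `L²` that tends to zero almost everywhere tends to zero weakly. -/
theorem tendsto_lintegral_mul_enorm_of_ae {u : ℕ → X → K} {M : ℝ≥0}
    (hu : ∀ n, AEStronglyMeasurable (u n) ν) (hM : ∀ n, eLpNorm (u n) 2 ν ≤ M)
    (hlim : ∀ᵐ x ∂ν, Tendsto (fun n => u n x) atTop (𝓝 0)) {G : X → ℂ} (hG : MemLp G 2 ν)
    (hG0 : ∀ x, G x ≠ 0) :
    Tendsto (fun n => ∫⁻ x, ‖G x‖ₑ * ‖u n x‖ₑ ∂ν) atTop (𝓝 0) := by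
  have hGfin : ∫⁻ x, ‖G x‖ₑ ^ 2 ∂ν ≠ ∞ := by
    rw [← eLpNorm_two_sq]
    exact ENNReal.pow_ne_top hG.eLpNorm_ne_top
  have hlim' : ∀ᵐ x ∂ν, Tendsto (fun n => ‖u n x‖ₑ) atTop (𝓝 0) := by
    filter_upwards [hlim] with x hx
    simpa using hx.enorm
  -- Off `B n` the integrand is at most `‖G‖²`, and dominated convergence applies. On `B n`
  -- Cauchy–Schwarz bounds the integral by `M` times the norm of `G` on `B n`; as `G` has no zeros,
  -- almost every point eventually leaves `B n`, so this norm tends to zero.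
  let B : ℕ → Set X := fun n => {x | ‖G x‖ₑ < ‖u n x‖ₑ}
  have hB : ∀ n, NullMeasurableSet (B n) ν := fun n =>
    nullMeasurableSet_lt hG.1.enorm (hu n).enorm
  have hGB : ∀ n, AEStronglyMeasurable ((B n).indicator G) ν := fun n => hG.1.indicator₀ (hB n)
  have h1 : Tendsto (fun n => ∫⁻ x, ‖G x‖ₑ * min ‖u n x‖ₑ ‖G x‖ₑ ∂ν) atTop (𝓝 0) := by
    have := tendsto_lintegral_of_dominated_convergence' (μ := ν)
      (F := fun n x => ‖G x‖ₑ * min ‖u n x‖ₑ ‖G x‖ₑ) (f := fun _ => 0) (fun x => ‖G x‖ₑ ^ 2)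
      (fun n => hG.1.enorm.mul ((hu n).enorm.min hG.1.enorm))
      (fun n => Eventually.of_forall fun x => by
        change _ * _ ≤ ‖G x‖ₑ ^ 2
        rw [sq]
        gcongr
        exact min_le_right _ _) hGfin ?_
    · simpa using this
    · filter_upwards [hlim'] with x hx
      have h2 : Tendsto (fun n => min ‖u n x‖ₑ ‖G x‖ₑ) atTop (𝓝 0) :=
        tendsto_of_tendsto_of_tendsto_of_le_of_le tendsto_const_nhds hx (fun _ => zero_le)
          fun _ => min_le_left _ _
      have h3 := ENNReal.Tendsto.const_mul (a := ‖G x‖ₑ) h2 (Or.inr enorm_ne_top)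
      simpa using h3
  have h2 : Tendsto (fun n => eLpNorm ((B n).indicator G) 2 ν) atTop (𝓝 0) := by
    have h3 : Tendsto (fun n => ∫⁻ x, ‖(B n).indicator G x‖ₑ ^ 2 ∂ν) atTop (𝓝 0) := by
      have := tendsto_lintegral_of_dominated_convergence' (μ := ν)
        (F := fun n x => ‖(B n).indicator G x‖ₑ ^ 2) (f := fun _ => 0) (fun x => ‖G x‖ₑ ^ 2)
        (fun n => (hGB n).enorm.pow_const 2)
        (fun n => Eventually.of_forall fun x => by
          change _ ^ 2 ≤ ‖G x‖ₑ ^ 2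
          gcongr
          exact enorm_indicator_le_enorm_self _ _) hGfin ?_
      · simpa using this
      · filter_upwards [hlim'] with x hx
        have h4 : ∀ᶠ n in atTop, ‖u n x‖ₑ < ‖G x‖ₑ :=
          hx.eventually_lt_const (by simpa [pos_iff_ne_zero] using hG0 x)
        refine tendsto_const_nhds.congr' ?_
        filter_upwards [h4] with n hn
        have : x ∉ B n := hn.not_gt
        simp [this]
    have h5 := h3.ennrpow_const (1 / 2 : ℝ)
    have h6 : ∀ n, (∫⁻ x, ‖(B n).indicator G x‖ₑ ^ 2 ∂ν) ^ (1 / 2 : ℝ) =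
        eLpNorm ((B n).indicator G) 2 ν := by
      intro n
      rw [← eLpNorm_two_sq, ← ENNReal.rpow_natCast, ← ENNReal.rpow_mul]
      simp
    simp_rw [h6] at h5
    simpa using h5
  have h7 : Tendsto (fun n => ∫⁻ x, ‖G x‖ₑ * min ‖u n x‖ₑ ‖G x‖ₑ ∂ν +
      eLpNorm ((B n).indicator G) 2 ν * M) atTop (𝓝 0) := by
    have h8 := h1.add (ENNReal.Tendsto.mul_const (b := (M : ℝ≥0∞)) h2 (Or.inr ENNReal.coe_ne_top))
    simpa using h8
  refine tendsto_of_tendsto_of_tendsto_of_le_of_le tendsto_const_nhds h7 (fun _ => zero_le)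
    fun n => ?_
  calc ∫⁻ x, ‖G x‖ₑ * ‖u n x‖ₑ ∂ν
      ≤ ∫⁻ x, (‖G x‖ₑ * min ‖u n x‖ₑ ‖G x‖ₑ + ‖(B n).indicator G x‖ₑ * ‖u n x‖ₑ) ∂ν := by
        refine lintegral_mono fun x => ?_
        by_cases hx : x ∈ B n
        · rw [Set.indicator_of_mem hx]
          exact le_add_self
        · have : min ‖u n x‖ₑ ‖G x‖ₑ = ‖u n x‖ₑ := min_eq_left (not_lt.1 hx)
          rw [this]
          exact le_self_add
    _ = ∫⁻ x, ‖G x‖ₑ * min ‖u n x‖ₑ ‖G x‖ₑ ∂ν + ∫⁻ x, ‖(B n).indicator G x‖ₑ * ‖u n x‖ₑ ∂ν :=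
        lintegral_add_left' (hG.1.enorm.mul ((hu n).enorm.min hG.1.enorm)) _
    _ ≤ _ := by
        gcongr
        exact (lintegral_mul_enorm_le (hGB n) (hu n)).trans (by gcongr; exact hM n)

end WeakConvergence

/-! ### Shifting the line of integration. -/

section ContourShift

variable {K : Type*} [NormedAddCommGroup K] [NormedSpace ℂ K]

/-- The integral over a horizontal line does not depend on the line, for a function that is analytic
in the upper half-plane and whose `L¹`-norms over the horizontal lines are bounded. -/
theorem integral_line_eq_of_bounded {φ : ℂ → K}
    (hd : DifferentiableOn ℂ φ {z | 0 < z.im}) {A : ℝ≥0}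
    (hA : ∀ y : ℝ, 0 < y → ∫⁻ x : ℝ, ‖φ (x + y * Complex.I)‖ₑ ≤ A) {y₁ y₂ : ℝ} (h1 : 0 < y₁)
    (h12 : y₁ ≤ y₂) :
    ∫ x : ℝ, φ (x + y₁ * Complex.I) = ∫ x : ℝ, φ (x + y₂ * Complex.I) := by
  have hline : ∀ y : ℝ, 0 < y → Continuous fun x : ℝ => φ (x + y * Complex.I) := fun y hy =>
    hd.continuousOn.comp_continuous (by fun_prop) fun x => by simpa using hy
  have hint : ∀ y : ℝ, 0 < y → Integrable fun x : ℝ => φ (x + y * Complex.I) := fun y hy =>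
    ⟨(hline y hy).aestronglyMeasurable, (hA y hy).trans_lt ENNReal.coe_lt_top⟩
  -- Clamping the height at `y₁` makes `ψ` continuous on the whole plane and changes nothing in the
  -- strip.
  let ψ : ℝ → ℝ → K := fun x y => φ (x + (max y y₁ : ℝ) * Complex.I)
  have hψ : Continuous (Function.uncurry ψ) :=
    hd.continuousOn.comp_continuous (by fun_prop) fun p => by
      simpa using Or.inr h1
  -- `V x` bounds the integral over the vertical side at abscissa `x`; by Tonelli it is integrable
  -- in `x`.
  let V : ℝ → ℝ≥0∞ := fun x => ∫⁻ y in Set.Ioc y₁ y₂, ‖ψ x y‖ₑ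
  have hVm : Measurable V := hψ.enorm.measurable.lintegral_prod_right'
  have hV : ∫⁻ x, V x ≠ ∞ := by
    change ∫⁻ x, ∫⁻ y in Set.Ioc y₁ y₂, ‖ψ x y‖ₑ ≠ ∞
    rw [lintegral_lintegral_swap hψ.enorm.measurable.aemeasurable]
    refine ne_top_of_le_ne_top (b := ∫⁻ y in Set.Ioc y₁ y₂, (A : ℝ≥0∞)) ?_ ?_
    · simp [ENNReal.mul_eq_top]
    · refine lintegral_mono fun y => ?_
      exact hA _ (lt_max_of_lt_right h1)
  have hV2 : ∫⁻ x, (V x + V (-x)) ≠ ∞ := by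
    rw [lintegral_add_left hVm,
      (Measure.measurePreserving_neg (volume : Measure ℝ)).lintegral_comp hVm]
    exact ENNReal.add_ne_top.2 ⟨hV, hV⟩
  have hrect : ∀ R : ℝ, 0 < R → ‖(∫ x in (-R)..R, φ (x + y₁ * Complex.I)) -
      ∫ x in (-R)..R, φ (x + y₂ * Complex.I)‖ₑ ≤ V R + V (-R) := by
    intro R hR
    have h := Complex.integral_boundary_rect_eq_zero_of_differentiableOn φ
      (-R + y₁ * Complex.I) (R + y₂ * Complex.I) (hd.mono ?_)
    · simp only [Complex.add_re, Complex.neg_re, Complex.ofReal_re, Complex.mul_re, Complex.I_re,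
        mul_zero, Complex.ofReal_im, Complex.I_im, mul_one, sub_self, add_zero, Complex.add_im,
        Complex.neg_im, neg_zero, Complex.mul_im, zero_add] at h
      have hbd : ∀ x : ℝ, ‖∫ y in y₁..y₂, φ (x + y * Complex.I)‖ₑ ≤ V x := by
        intro x
        rw [intervalIntegral.integral_of_le h12]
        refine (enorm_integral_le_lintegral_enorm _).trans (le_of_eq ?_)
        refine setLIntegral_congr_fun measurableSet_Ioc fun y hy => ?_
        simp only [ψ]
        rw [max_eq_left hy.1.le]
      have h' : (∫ x in (-R)..R, φ (x + y₁ * Complex.I)) -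
          ∫ x in (-R)..R, φ (x + y₂ * Complex.I) =
          Complex.I • (∫ y in y₁..y₂, φ ((-R : ℝ) + y * Complex.I)) -
            Complex.I • ∫ y in y₁..y₂, φ ((R : ℝ) + y * Complex.I) := by
        rw [← sub_eq_zero, ← h]
        push_cast
        abel
      rw [h', add_comm (V R)]
      refine (enorm_sub_le).trans ?_
      rw [enorm_smul, enorm_smul]
      have hI : ‖Complex.I‖ₑ = 1 := by simp [enorm]
      rw [hI, one_mul, one_mul]
      exact add_le_add (hbd _) (hbd _)
    · intro z hz
      have h2 := hz.2
      simp only [Complex.add_im, Complex.neg_im, Complex.ofReal_im, neg_zero, Complex.mul_im,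
        Complex.ofReal_re, Complex.I_im, mul_one, Complex.I_re, mul_zero, add_zero, zero_add,
        Set.mem_preimage, Set.uIcc_of_le h12] at h2
      exact h1.trans_le h2.1
  -- If the two integrals differed, `V R + V (-R)` would stay above some `δ > 0` for all large `R`,
  -- a set of infinite measure. By Markov's inequality this contradicts integrability, and no
  -- pointwise decay of `φ` is needed.
  by_contra hne
  set D : K := (∫ x : ℝ, φ (x + y₁ * Complex.I)) - ∫ x : ℝ, φ (x + y₂ * Complex.I) with hD
  have hD0 : 0 < ‖D‖ₑ := by simpa [hD, sub_eq_zero, pos_iff_ne_zero] using hne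
  have htend : Tendsto (fun R : ℝ => ‖(∫ x in (-R)..R, φ (x + y₁ * Complex.I)) -
      ∫ x in (-R)..R, φ (x + y₂ * Complex.I)‖ₑ) atTop (𝓝 ‖D‖ₑ) :=
    ((intervalIntegral_tendsto_integral (hint y₁ h1) tendsto_neg_atTop_atBot tendsto_id).sub
      (intervalIntegral_tendsto_integral (hint y₂ (h1.trans_le h12)) tendsto_neg_atTop_atBot
        tendsto_id)).enorm
  obtain ⟨δ, hδ0, hδ⟩ := exists_between hD0
  have hev : ∀ᶠ R : ℝ in atTop, δ ≤ V R + V (-R) := by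
    filter_upwards [htend.eventually_const_lt hδ, eventually_gt_atTop 0] with R hR hR0
    exact hR.le.trans (hrect R hR0)
  obtain ⟨R₀, hR₀⟩ := eventually_atTop.1 hev
  have hsub : Set.Ici R₀ ⊆ {x | δ ≤ V x + V (-x)} := fun x hx => hR₀ x hx
  have hmeas := meas_ge_le_lintegral_div (μ := (volume : Measure ℝ)) (f := fun x => V x + V (-x))
    (hVm.add (hVm.comp measurable_neg)).aemeasurable hδ0.ne' (hδ.trans (enorm_lt_top)).ne
  have h3 := (measure_mono hsub).trans hmeas
  rw [Real.volume_Ici, top_le_iff] at h3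
  exact ENNReal.div_ne_top hV2 hδ0.ne' h3

end ContourShift

/-! ### The Paley–Wiener theorem. -/

section HardyFourier

open FourierTransform
open scoped Real ComplexConjugate

variable {K : Type*} [NormedAddCommGroup K] [InnerProductSpace ℂ K]

/-- The Cauchy kernel `x ↦ (x - w)⁻¹ k` as an element of `L²(ℝ; K)`. -/
def cauchyKernel {w : ℂ} (hw : w.im ≠ 0) (k : K) : L2Line K :=
  (memLp_two_smul_const (memLp_inv_ofReal_sub hw) k).toLp _

theorem cauchyKernel_coeFn {w : ℂ} (hw : w.im ≠ 0) (k : K) :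
    cauchyKernel hw k =ᵐ[volume] fun x : ℝ => ((x : ℂ) - w)⁻¹ • k :=
  MemLp.coeFn_toLp _

theorem inner_cauchyKernel [CompleteSpace K] {w : ℂ} (hw : w.im ≠ 0) (k : K) (f : L2Line K) :
    ⟪cauchyKernel hw k, f⟫_ℂ = ⟪k, ∫ x : ℝ, ((x : ℂ) - conj w)⁻¹ • f x⟫_ℂ := by
  have hw' : (conj w).im ≠ 0 := by simpa using hw
  rw [← integral_inner (integrable_smul_of_memLp_two (memLp_inv_ofReal_sub hw') (Lp.memLp f)),
    L2.inner_def]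
  refine integral_congr_ae ?_
  filter_upwards [cauchyKernel_coeFn hw k] with x h1
  rw [h1, inner_smul_left, inner_smul_right]
  simp

theorem sub_ne_zero_of_im {z w : ℂ} (hz : 0 < z.im) (hw : w.im < 0) : z - w ≠ 0 := by
  intro h
  rw [sub_eq_zero] at h
  rw [h] at hz
  linarith

theorem line_sub_eq (x y : ℝ) (w : ℂ) :
    ((x : ℂ) + y * Complex.I) - w = (x : ℂ) - (w - y * Complex.I) := by ring

theorem im_sub_mul_I (w : ℂ) (y : ℝ) : (w - y * Complex.I).im = w.im - y := by simp

/-- The pole lies below the real axis, and the squared norm on the line at height `y` is `‖k‖² π /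
(y + |Im w|)`, largest as `y → 0`. -/
theorem cauchyKernel_mem_hardyPlus {w : ℂ} (hw : w.im < 0) (k : K) :
    cauchyKernel hw.ne k ∈ hardyPlus K := by
  refine ⟨fun z => (z - w)⁻¹ • k, ⟨?_, ‖k‖₊ ^ 2 * (π / |w.im|).toNNReal, fun y hy => ?_⟩, ?_⟩
  · intro z hz
    have := sub_ne_zero_of_im hz hw
    exact (((differentiableAt_id.sub_const w).inv this).smul_const k).differentiableWithinAt
  · have him : (w - y * Complex.I).im ≠ 0 := by
      rw [im_sub_mul_I]
      linarith
    simp_rw [enorm_smul, mul_pow, line_sub_eq]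
    rw [lintegral_mul_const' _ _ (by simp), lintegral_enorm_sq_inv_ofReal_sub him, im_sub_mul_I,
      mul_comm, abs_of_neg (by linarith), abs_of_neg hw]
    push_cast
    refine mul_le_mul' le_rfl ?_
    refine ENNReal.ofReal_le_ofReal ?_
    gcongr <;> linarith
  · filter_upwards [cauchyKernel_coeFn hw.ne k] with x hx
    rw [hx]
    have h0 := ofReal_sub_ne_zero hw.ne x
    have hc : ContinuousAt (fun y : ℝ => ((x : ℂ) + y * Complex.I - w)⁻¹ • k) 0 := by
      refine ContinuousAt.smul (ContinuousAt.inv₀ (by fun_prop) ?_) continuousAt_const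
      simpa using h0
    have := hc.tendsto
    simp only [Complex.ofReal_zero, zero_mul, add_zero] at this
    exact this.mono_left nhdsWithin_le_nhds

theorem IsHardyUpper.memLp_line {F : ℂ → K} (hF : IsHardyUpper F) {y : ℝ} (hy : 0 < y) :
    MemLp (fun x : ℝ => F (x + y * Complex.I)) 2 volume := by
  obtain ⟨C, hC⟩ := hF.2
  refine ⟨(hF.continuous_line K hy).aestronglyMeasurable, ?_⟩
  have h : eLpNorm (fun x : ℝ => F (x + y * Complex.I)) 2 volume ^ 2 < ∞ := by
    rw [eLpNorm_two_sq]
    exact (hC y hy).trans_lt ENNReal.coe_lt_top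
  exact (ENNReal.pow_lt_top_iff.1 h).resolve_right two_ne_zero

theorem IsHardyUpper.exists_eLpNorm_line_le {F : ℂ → K} (hF : IsHardyUpper F) :
    ∃ M : ℝ≥0, ∀ y : ℝ, 0 < y →
      eLpNorm (fun x : ℝ => F (x + y * Complex.I)) 2 volume ≤ M := by
  obtain ⟨C, hC⟩ := hF.2
  -- `C` bounds the squared norms; since `(C + 1)² > C`, `C + 1` bounds the norms.
  refine ⟨C + 1, fun y hy => ?_⟩
  by_contra! h
  have h1 : ((C + 1 : ℝ≥0) : ℝ≥0∞) ^ 2 ≤ C := by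
    refine le_trans (pow_le_pow_left' h.le 2) ?_
    rw [eLpNorm_two_sq]
    exact hC y hy
  norm_cast at h1
  have h2 : (C + 1 : ℝ) ^ 2 ≤ C := by exact_mod_cast h1
  nlinarith [C.coe_nonneg]

theorem eLpNorm_inv_line {w : ℂ} (hw : w.im < 0) {y : ℝ} (hy : 0 < y) :
    eLpNorm (fun x : ℝ => ((x : ℂ) + y * Complex.I - w)⁻¹) 2 volume =
      ENNReal.ofReal (π / (y - w.im)) ^ (1 / 2 : ℝ) := by
  have him : (w - y * Complex.I).im ≠ 0 := by
    rw [im_sub_mul_I]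
    linarith
  have h := eLpNorm_two_sq (ν := volume) (fun x : ℝ => ((x : ℂ) + y * Complex.I - w)⁻¹)
  simp_rw [line_sub_eq] at h ⊢
  rw [lintegral_enorm_sq_inv_ofReal_sub him, im_sub_mul_I, abs_of_neg (by linarith), neg_sub] at h
  rw [← h, ← ENNReal.rpow_natCast, ← ENNReal.rpow_mul]
  simp

/-- The Cauchy integral of a Hardy function over a line, at a point of the lower half-plane,
vanishes. -/
theorem IsHardyUpper.integral_line_eq_zero {F : ℂ → K} (hF : IsHardyUpper F) {w : ℂ}
    (hw : w.im < 0) {y : ℝ} (hy : 0 < y) :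
    ∫ x : ℝ, ((x : ℂ) + y * Complex.I - w)⁻¹ • F (x + y * Complex.I) = 0 := by
  obtain ⟨M, hM⟩ := hF.exists_eLpNorm_line_le
  let φ : ℂ → K := fun z => (z - w)⁻¹ • F z
  have hd : DifferentiableOn ℂ φ {z | 0 < z.im} := by
    refine DifferentiableOn.smul (DifferentiableOn.inv (by fun_prop) ?_) hF.1
    exact fun z hz => sub_ne_zero_of_im hz hw
  -- By Cauchy–Schwarz the `L¹`-norm on the line at height `y` is `O((y - Im w)^{-1/2})`. It is
  -- bounded, so the integral does not depend on `y`, and it tends to zero as `y → ∞`, so the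
  -- integral is zero.
  have hbound : ∀ y : ℝ, 0 < y → ∫⁻ x : ℝ, ‖φ (x + y * Complex.I)‖ₑ ≤
      ENNReal.ofReal (π / (y - w.im)) ^ (1 / 2 : ℝ) * M := by
    intro y hy
    simp only [φ, enorm_smul]
    refine (lintegral_mul_enorm_le ?_ (hF.memLp_line hy).1).trans ?_
    · refine Continuous.aestronglyMeasurable (Continuous.inv₀ (by fun_prop) fun x => ?_)
      exact sub_ne_zero_of_im (by simpa using hy) hw
    · rw [eLpNorm_inv_line hw hy]
      gcongr
      exact hM y hy
  have hA : ∀ y : ℝ, 0 < y → ∫⁻ x : ℝ, ‖φ (x + y * Complex.I)‖ₑ ≤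
      (((π / (-w.im)).toNNReal ^ (1 / 2 : ℝ) * M : ℝ≥0) : ℝ≥0∞) := by
    intro y hy
    refine (hbound y hy).trans ?_
    push_cast
    rw [ENNReal.coe_rpow_of_nonneg _ (by norm_num)]
    gcongr
    change ENNReal.ofReal _ ≤ ENNReal.ofReal _
    refine ENNReal.ofReal_le_ofReal ?_
    gcongr
    · linarith
    · linarith
  have hlim : Tendsto (fun y : ℝ => ENNReal.ofReal (π / (y - w.im)) ^ (1 / 2 : ℝ) * M) atTop
      (𝓝 0) := by
    have h1 : Tendsto (fun y : ℝ => π / (y - w.im)) atTop (𝓝 0) :=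
      tendsto_const_nhds.div_atTop (tendsto_atTop_add_const_right _ (-w.im) tendsto_id)
    have h2 := (ENNReal.tendsto_ofReal h1).ennrpow_const (1 / 2 : ℝ)
    have h3 := ENNReal.Tendsto.mul_const (b := (M : ℝ≥0∞)) h2 (Or.inr ENNReal.coe_ne_top)
    simpa using h3
  have hle : ∀ᶠ y' : ℝ in atTop, ‖∫ x : ℝ, φ (x + y * Complex.I)‖ₑ ≤
      ENNReal.ofReal (π / (y' - w.im)) ^ (1 / 2 : ℝ) * M := by
    filter_upwards [eventually_ge_atTop y] with y' hy'
    rw [integral_line_eq_of_bounded hd hA hy hy']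
    exact (enorm_integral_le_lintegral_enorm _).trans (hbound y' (hy.trans_le hy'))
  have h0 := ge_of_tendsto hlim hle
  simpa using h0

/-- The Cauchy transform of an element of the Hardy space vanishes in the lower half-plane. -/
theorem integral_inv_sub_smul_eq_zero_of_mem_hardyPlus [CompleteSpace K] {f : L2Line K}
    (hf : f ∈ hardyPlus K) {w : ℂ} (hw : w.im < 0) : ∫ x : ℝ, ((x : ℂ) - w)⁻¹ • f x = 0 := by
  obtain ⟨F, hF, hbv⟩ := hf
  obtain ⟨M, hM⟩ := hF.exists_eLpNorm_line_le
  -- The Cauchy integral of `F` vanishes at each height `y n`. As `y n → 0`, the functions `F(· + i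
  -- y n) - f` are bounded in `L²` and tend to zero almost everywhere; weak convergence is then
  -- enough to pass to the boundary.
  let y : ℕ → ℝ := fun n => 1 / ((n : ℝ) + 1)
  have hy : ∀ n, 0 < y n := fun n => by positivity
  have hy0 : Tendsto y atTop (𝓝 0) := tendsto_one_div_add_atTop_nhds_zero_nat
  have hy0' : Tendsto y atTop (𝓝[>] 0) :=
    tendsto_nhdsWithin_of_tendsto_nhds_of_eventually_within _ hy0 (Eventually.of_forall hy)
  let φ : ℕ → ℝ → ℂ := fun n x => ((x : ℂ) + y n * Complex.I - w)⁻¹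
  let u : ℕ → ℝ → K := fun n x => F (x + y n * Complex.I) - f x
  have hφc : ∀ n, Continuous (φ n) := fun n =>
    Continuous.inv₀ (by fun_prop) fun x => sub_ne_zero_of_im (by simpa using hy n) hw
  -- Since `Im w < 0`, raising the line increases the distance to `w`.
  have hφle : ∀ n x, ‖φ n x‖ ≤ ‖((x : ℂ) - w)⁻¹‖ := by
    intro n x
    have h1 := norm_sq_inv_ofReal_sub (w - y n * Complex.I) x
    have h2 := norm_sq_inv_ofReal_sub w x
    rw [← line_sub_eq] at h1
    refine (pow_le_pow_iff_left₀ (norm_nonneg _) (norm_nonneg _) two_ne_zero).1 ?_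
    simp only [φ]
    rw [h1, h2]
    have h3 : 0 < w.im ^ 2 := by
      have := hw.ne
      positivity
    have h4 := hy n
    refine inv_anti₀ (by positivity) ?_
    simp only [Complex.sub_re, Complex.mul_re, Complex.ofReal_re, Complex.I_re, mul_zero,
      Complex.ofReal_im, Complex.I_im, mul_one, sub_self, sub_zero, Complex.sub_im, Complex.mul_im,
      add_zero]
    nlinarith
  have hGm := memLp_inv_ofReal_sub hw.ne
  have hum : ∀ n, MemLp (u n) 2 volume := fun n => (hF.memLp_line (hy n)).sub (Lp.memLp f)
  have hulim : ∀ᵐ x : ℝ, Tendsto (fun n => u n x) atTop (𝓝 0) := by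
    filter_upwards [hbv] with x hx
    simpa [u] using (hx.comp hy0').sub_const (f x)
  have hubd : ∀ n, eLpNorm (u n) 2 volume ≤ ((M + (eLpNorm f 2 volume).toNNReal : ℝ≥0) : ℝ≥0∞) := by
    intro n
    refine (eLpNorm_sub_le (hF.memLp_line (hy n)).1 (Lp.aestronglyMeasurable f) one_le_two).trans ?_
    push_cast
    rw [ENNReal.coe_toNNReal (Lp.eLpNorm_ne_top f)]
    gcongr
    exact hM _ (hy n)
  have hweak := tendsto_lintegral_mul_enorm_of_ae (fun n => (hum n).1) hubd hulim hGm
    fun x => inv_ne_zero (ofReal_sub_ne_zero hw.ne x)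
  have hφm : ∀ n, MemLp (φ n) 2 volume := fun n =>
    hGm.of_le (hφc n).aestronglyMeasurable (Eventually.of_forall (hφle n))
  have hzero : Tendsto (fun n => ∫ x, φ n x • u n x) atTop (𝓝 0) := by
    rw [tendsto_zero_iff_enorm_tendsto_zero]
    refine tendsto_of_tendsto_of_tendsto_of_le_of_le tendsto_const_nhds hweak (fun _ => zero_le)
      fun n => (enorm_integral_le_lintegral_enorm _).trans (lintegral_mono fun x => ?_)
    rw [enorm_smul]
    gcongr
    exact enorm_le_iff_norm_le.2 (hφle n x)
  have hsplit : ∀ n, ∫ x, φ n x • u n x = -∫ x, φ n x • f x := by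
    intro n
    have h1 := hF.integral_line_eq_zero hw (hy n)
    have h2 : ∀ x, φ n x • u n x =
        ((x : ℂ) + y n * Complex.I - w)⁻¹ • F (x + y n * Complex.I) - φ n x • f x := fun x => by
      simp only [φ, u, smul_sub]
    simp_rw [h2]
    rw [integral_sub (integrable_smul_of_memLp_two (hφm n) (hF.memLp_line (hy n)))
      (integrable_smul_of_memLp_two (hφm n) (Lp.memLp f)), h1, zero_sub]
  have hdct : Tendsto (fun n => ∫ x, φ n x • f x) atTop (𝓝 (∫ x : ℝ, ((x : ℂ) - w)⁻¹ • f x)) := by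
    refine tendsto_integral_of_dominated_convergence (fun x => ‖((x : ℂ) - w)⁻¹ • f x‖)
      (fun n => (integrable_smul_of_memLp_two (hφm n) (Lp.memLp f)).1)
      (integrable_smul_of_memLp_two hGm (Lp.memLp f)).norm
      (fun n => Eventually.of_forall fun x => ?_) (Eventually.of_forall fun x => ?_)
    · rw [norm_smul, norm_smul]
      gcongr
      exact hφle n x
    · refine Tendsto.smul_const ?_ _
      refine Tendsto.inv₀ ?_ (ofReal_sub_ne_zero hw.ne x)
      have h1 : Tendsto (fun n => ((y n : ℝ) : ℂ)) atTop (𝓝 0) := by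
        exact_mod_cast (Complex.continuous_ofReal.tendsto 0).comp hy0
      have h2 := ((h1.mul_const Complex.I).const_add (x : ℂ)).sub_const w
      simpa using h2
  simp_rw [hsplit] at hzero
  have := tendsto_nhds_unique hdct.neg hzero
  simpa using this

variable (K) in
/-- The functions whose Fourier transform vanishes on the negative half-line. -/
def fourierPos [CompleteSpace K] : Submodule ℂ (L2Line K) :=
  (L2Pos K).comap (Lp.fourierTransformₗᵢ ℝ K).toLinearEquiv.toLinearMap

theorem mem_fourierPos [CompleteSpace K] {f : L2Line K} :
    f ∈ fourierPos K ↔ ∀ᵐ s : ℝ, s < 0 → (𝓕 f : L2Line K) s = 0 := Iff.rfl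

theorem hardyPlus_le_fourierPos [CompleteSpace K] : hardyPlus K ≤ fourierPos K := by
  intro f hf
  rw [mem_fourierPos]
  -- For `Im v = 1` the Cauchy transform is evaluated at `conj v`, in the lower half-plane.
  have h := fourier_ae_eq_zero_of_cauchy (f := f) (b := 1) one_ne_zero fun v hv =>
    integral_inv_sub_smul_eq_zero_of_mem_hardyPlus hf (by simp [hv])
  simpa using h

theorem isClosed_fourierPos [CompleteSpace K] : IsClosed (fourierPos K : Set (L2Line K)) :=
  (isClosed_L2Pos K).preimage (Lp.fourierTransformₗᵢ ℝ K).continuous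

/-- A function that is orthogonal to the Hardy space has a Fourier transform that vanishes on the
positive half-line. -/
theorem fourier_ae_eq_zero_of_mem_orthogonal [CompleteSpace K] {g : L2Line K}
    (hg : g ∈ (hardyPlus K)ᗮ) : ∀ᵐ s : ℝ, 0 < s → (𝓕 g : L2Line K) s = 0 := by
  have h := fourier_ae_eq_zero_of_cauchy (f := g) (b := -1) (by norm_num) fun v hv => by
    have hv' : v.im < 0 := by rw [hv]; norm_num
    refine ext_inner_left ℂ fun k => ?_
    rw [← inner_cauchyKernel hv'.ne, inner_zero_right]
    exact hg _ (cauchyKernel_mem_hardyPlus hv' k)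
  simpa using h

/-- The theorem of Paley and Wiener. -/
theorem topologicalClosure_hardyPlus [CompleteSpace K] :
    (hardyPlus K).topologicalClosure = fourierPos K := by
  refine le_antisymm
    (Submodule.topologicalClosure_minimal _ hardyPlus_le_fourierPos isClosed_fourierPos) ?_
  -- A vector orthogonal to the Hardy space has its transform on the negative half-line, an element
  -- of `fourierPos` on the positive one, so Plancherel makes them orthogonal. The Cauchy kernels
  -- are the only Hardy functions that have to be exhibited.
  rw [← Submodule.orthogonal_orthogonal_eq_closure]
  intro f hf g hg
  rw [mem_fourierPos] at hf
  rw [← Lp.inner_fourier_eq, L2.inner_def]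
  refine integral_eq_zero_of_ae ?_
  have hne : ∀ᵐ s : ℝ, s ≠ 0 := by simp [ae_iff]
  filter_upwards [hf, fourier_ae_eq_zero_of_mem_orthogonal hg, hne] with s h1 h2 h3
  rcases lt_or_gt_of_ne h3 with h | h
  · rw [h1 h, inner_zero_right, Pi.zero_apply]
  · rw [h2 h, inner_zero_left, Pi.zero_apply]

end HardyFourier

/-! ### Uniqueness for functions and transforms supported on half-lines. -/

section HalfLineUniqueness

open FourierTransform
open scoped Real ComplexConjugate

variable {K : Type*} [NormedAddCommGroup K] [InnerProductSpace ℂ K] [CompleteSpace K]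

theorem isOpen_compl_ofReal_image {S : Set ℝ} (hS : IsClosed S) :
    IsOpen (((↑) : ℝ → ℂ) '' S)ᶜ :=
  (Complex.isometry_ofReal.isClosedEmbedding.isClosedMap S hS).isOpen_compl

/-- The Cauchy transform of a function that vanishes outside of `S` is analytic outside of `S`. -/
theorem differentiableOn_cauchy {S : Set ℝ} (hS : IsClosed S) {f : L2Line K}
    (hf : ∀ᵐ x : ℝ, x ∉ S → f x = 0) :
    DifferentiableOn ℂ (fun w : ℂ => ∫ x : ℝ, ((x : ℂ) - w)⁻¹ • f x) (((↑) : ℝ → ℂ) '' S)ᶜ := by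
  intro w₀ hw₀
  obtain ⟨δ, hδ, hball⟩ := Metric.isOpen_iff.1 (isOpen_compl_ofReal_image hS) w₀ hw₀
  have hdist : ∀ x ∈ S, δ ≤ ‖(x : ℂ) - w₀‖ := by
    intro x hx
    by_contra! h
    refine hball (a := (x : ℂ)) ?_ ⟨x, hx, rfl⟩
    rwa [Metric.mem_ball, dist_eq_norm]
  have hI : (Complex.I).im ≠ 0 := by simp
  -- The point `w₀` may be real, so the kernel at `w₀` is compared on `S` with the square integrable
  -- kernel at `i`: `|x - i| ≤ |x - w₀| + |w₀ - i| ≤ C |x - w₀|`.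
  set C : ℝ := 1 + ‖w₀ - Complex.I‖ / δ with hC
  have hC0 : 0 < C := by positivity
  have hinv : ∀ x ∈ S, ‖(x : ℂ) - w₀‖⁻¹ ≤ C * ‖((x : ℂ) - Complex.I)⁻¹‖ := by
    intro x hx
    have h1 := hdist x hx
    have h2 : 0 < ‖(x : ℂ) - w₀‖ := hδ.trans_le h1
    have h3 : 0 < ‖(x : ℂ) - Complex.I‖ := norm_pos_iff.2 (ofReal_sub_ne_zero hI x)
    rw [norm_inv, ← div_eq_mul_inv, le_div_iff₀ h3, inv_mul_le_iff₀ h2]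
    calc ‖(x : ℂ) - Complex.I‖ = ‖((x : ℂ) - w₀) + (w₀ - Complex.I)‖ := by ring_nf
      _ ≤ ‖(x : ℂ) - w₀‖ + ‖w₀ - Complex.I‖ := norm_add_le _ _
      _ = ‖(x : ℂ) - w₀‖ + δ * (‖w₀ - Complex.I‖ / δ) := by
        rw [mul_div_cancel₀ _ hδ.ne']
      _ ≤ ‖(x : ℂ) - w₀‖ + ‖(x : ℂ) - w₀‖ * (‖w₀ - Complex.I‖ / δ) := by gcongr
      _ = ‖(x : ℂ) - w₀‖ * C := by rw [hC]; ring
  have hmeas : ∀ w : ℂ, AEStronglyMeasurable (fun x : ℝ => ((x : ℂ) - w)⁻¹ • f x) volume := by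
    intro w
    have : Measurable fun x : ℝ => ((x : ℂ) - w)⁻¹ := by fun_prop
    exact this.aestronglyMeasurable.smul (Lp.aestronglyMeasurable f)
  have hmeas' : AEStronglyMeasurable (fun x : ℝ => (((x : ℂ) - w₀) ^ 2)⁻¹ • f x) volume := by
    have : Measurable fun x : ℝ => (((x : ℂ) - w₀) ^ 2)⁻¹ := by fun_prop
    exact this.aestronglyMeasurable.smul (Lp.aestronglyMeasurable f)
  have hJ : Integrable fun x : ℝ => ‖((x : ℂ) - Complex.I)⁻¹ • f x‖ :=
    (integrable_smul_of_memLp_two (memLp_inv_ofReal_sub hI) (Lp.memLp f)).norm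
  have hint : Integrable (fun x : ℝ => ((x : ℂ) - w₀)⁻¹ • f x) volume := by
    refine (hJ.const_mul C).mono' (hmeas w₀) ?_
    filter_upwards [hf] with x hx
    by_cases hxS : x ∈ S
    · rw [norm_smul, norm_smul, ← mul_assoc, norm_inv]
      gcongr
      exact hinv x hxS
    · simp [hx hxS]
  -- For `w` in the ball of radius `δ / 2`, `|x - w|` is at least `δ / 2` and at least `|x - w₀| /
  -- 2`. One factor of `|x - w|⁻²` is bounded by `2 / δ`, the other by `2C` times the kernel at `i`.
  have hmain := hasDerivAt_integral_of_dominated_loc_of_deriv_le (𝕜 := ℂ) (μ := volume)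
    (F := fun (w : ℂ) (x : ℝ) => ((x : ℂ) - w)⁻¹ • f x)
    (F' := fun (w : ℂ) (x : ℝ) => (((x : ℂ) - w) ^ 2)⁻¹ • f x) (x₀ := w₀)
    (s := Metric.ball w₀ (δ / 2))
    (bound := fun x : ℝ => 2 / δ * (2 * C) * ‖((x : ℂ) - Complex.I)⁻¹ • f x‖)
    (Metric.ball_mem_nhds w₀ (half_pos hδ)) (Eventually.of_forall hmeas) hint hmeas' ?_
    (hJ.const_mul _) ?_
  · exact hmain.2.differentiableAt.differentiableWithinAt
  · filter_upwards [hf] with x hx w hw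
    by_cases hxS : x ∈ S
    · have h1 := hdist x hxS
      rw [Metric.mem_ball, dist_eq_norm] at hw
      have h2 : ‖(x : ℂ) - w₀‖ ≤ ‖(x : ℂ) - w‖ + ‖w - w₀‖ := by
        simpa using norm_add_le ((x : ℂ) - w) (w - w₀)
      have h3 : δ / 2 ≤ ‖(x : ℂ) - w‖ := by linarith
      have h4 : ‖(x : ℂ) - w₀‖ / 2 ≤ ‖(x : ℂ) - w‖ := by linarith
      have h5 : ‖(x : ℂ) - w‖⁻¹ ≤ 2 / δ := by
        rw [← inv_div]
        exact inv_anti₀ (half_pos hδ) h3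
      have h6 : ‖(x : ℂ) - w‖⁻¹ ≤ 2 * C * ‖((x : ℂ) - Complex.I)⁻¹‖ := by
        refine (inv_anti₀ (by linarith) h4).trans ?_
        rw [inv_div, div_eq_mul_inv, mul_assoc]
        gcongr
        exact hinv x hxS
      rw [norm_smul, norm_smul, ← mul_assoc, norm_inv, norm_pow, ← inv_pow, sq, mul_assoc (2 / δ)]
      gcongr
    · simp [hx hxS]
  · filter_upwards [hf] with x hx w hw
    by_cases hxS : x ∈ S
    · have h1 := hdist x hxS
      rw [Metric.mem_ball, dist_eq_norm] at hw
      have h2 : ‖(x : ℂ) - w₀‖ ≤ ‖(x : ℂ) - w‖ + ‖w - w₀‖ := by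
        simpa using norm_add_le ((x : ℂ) - w) (w - w₀)
      have h3 : (x : ℂ) - w ≠ 0 := norm_pos_iff.1 (by linarith)
      have h4 : HasDerivAt (fun w : ℂ => ((x : ℂ) - w)⁻¹) ((((x : ℂ) - w) ^ 2)⁻¹) w := by
        have h5 := ((hasDerivAt_id' w).const_sub (x : ℂ)).fun_inv h3
        rwa [neg_neg, one_div] at h5
      exact h4.smul_const _
    · simpa [hx hxS] using hasDerivAt_const w (0 : K)

/-- If `f` vanishes outside of a closed set `S` with a connected complement in `ℂ`, and the Fourier
transform of `f` vanishes on a half-line, then `f` is zero. -/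
theorem eq_zero_of_fourier_half_line {S : Set ℝ} (hS : IsClosed S)
    (hconn : IsPreconnected (((↑) : ℝ → ℂ) '' S)ᶜ) {f : L2Line K}
    (hf : ∀ᵐ x : ℝ, x ∉ S → f x = 0) {b : ℝ} (hb : b ≠ 0)
    (h : ∀ᵐ s : ℝ, s * b < 0 → (𝓕 f : L2Line K) s = 0) : f = 0 := by
  have hmem : ∀ w : ℂ, w.im ≠ 0 → w ∈ (((↑) : ℝ → ℂ) '' S)ᶜ := by
    rintro w hw ⟨r, -, rfl⟩
    simp at hw
  -- The Cauchy transform is analytic on the connected complement of `S` and vanishes on a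
  -- half-plane, hence everywhere there. Vanishing in both half-planes removes `𝓕 f` from both
  -- half-lines.
  have han := (differentiableOn_cauchy hS hf).analyticOnNhd (isOpen_compl_ofReal_image hS)
  have hz₀ : (conj ((b : ℂ) * Complex.I)).im ≠ 0 := by simpa using hb
  have hev : (fun w : ℂ => ∫ x : ℝ, ((x : ℂ) - w)⁻¹ • f x) =ᶠ[𝓝 (conj ((b : ℂ) * Complex.I))] 0 := by
    have hopen : IsOpen {w : ℂ | w.im * b < 0} :=
      isOpen_lt (by fun_prop) continuous_const
    have hin : conj ((b : ℂ) * Complex.I) ∈ {w : ℂ | w.im * b < 0} := by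
      have : 0 < b * b := mul_self_pos.2 hb
      simpa using this
    filter_upwards [hopen.mem_nhds hin] with w hw
    have hw' : w.im * b < 0 := hw
    have hv : (conj w).im ≠ 0 := by
      intro h0
      rw [Complex.conj_im, neg_eq_zero] at h0
      rw [h0, zero_mul] at hw'
      exact lt_irrefl _ hw'
    have := cauchy_eq_zero_of_fourier (f := f) hv (by
      filter_upwards [h] with s hs hsv
      refine hs ?_
      rw [Complex.conj_im] at hsv
      have h2 : 0 < (s * -w.im) * (w.im * b) := mul_pos_of_neg_of_neg hsv hw'
      have h3 : 0 < w.im * w.im := by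
        have : w.im ≠ 0 := by simpa using hv
        exact mul_self_pos.2 this
      by_contra! h4
      nlinarith [mul_nonneg h4 h3.le])
    rwa [Complex.conj_conj] at this
  have hall := han.eqOn_zero_of_preconnected_of_eventuallyEq_zero hconn (hmem _ hz₀) hev
  have hF : ∀ b : ℝ, b ≠ 0 → ∀ᵐ s : ℝ, s * b < 0 → (𝓕 f : L2Line K) s = 0 := fun b hb =>
    fourier_ae_eq_zero_of_cauchy hb fun v hv => hall (hmem _ (by
      rw [Complex.conj_im, hv]
      exact neg_ne_zero.2 hb))
  have hne : ∀ᵐ s : ℝ, s ≠ 0 := by simp [ae_iff]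
  have h0 : (𝓕 f : L2Line K) = 0 := by
    apply Lp.ext
    filter_upwards [hF 1 one_ne_zero, hF (-1) (by norm_num), hne,
      Lp.coeFn_zero K 2 (volume : Measure ℝ)] with s h1 h2 h3 h4
    rw [h4, Pi.zero_apply]
    rcases lt_or_gt_of_ne h3 with h | h
    · exact h1 (by linarith)
    · exact h2 (by linarith)
  exact (Lp.fourierTransformₗᵢ ℝ K).map_eq_zero_iff.1 h0

theorem compl_ofReal_image_Iic : (((↑) : ℝ → ℂ) '' Set.Iic 0)ᶜ = Complex.slitPlane := by
  ext z
  rw [Set.mem_compl_iff, Complex.mem_slitPlane_iff]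
  constructor
  · intro h
    by_contra! h1
    exact h ⟨z.re, h1.1, Complex.ext rfl (by simp [h1.2])⟩
  · rintro h ⟨r, hr, rfl⟩
    rw [Set.mem_Iic] at hr
    simp at h
    linarith

theorem isPreconnected_compl_Iic : IsPreconnected (((↑) : ℝ → ℂ) '' Set.Iic 0)ᶜ := by
  rw [compl_ofReal_image_Iic]
  exact (Complex.starConvex_one_slitPlane.isPathConnected
    Complex.one_mem_slitPlane).isConnected.isPreconnected

theorem isPreconnected_compl_Ici : IsPreconnected (((↑) : ℝ → ℂ) '' Set.Ici 0)ᶜ := by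
  have h := isPreconnected_compl_Iic.image (fun z : ℂ => -z) (by fun_prop)
  convert h using 1
  ext z
  simp only [Set.mem_compl_iff, Set.mem_image]
  constructor
  · intro hz
    refine ⟨-z, ?_, neg_neg z⟩
    rintro ⟨r, hr, h⟩
    exact hz ⟨-r, by simpa using hr, by simp [h]⟩
  · rintro ⟨w, hw, rfl⟩ ⟨r, hr, h⟩
    exact hw ⟨-r, by simpa using hr, by simp [h]⟩

end HalfLineUniqueness

/-! ### Polar decomposition. -/

section Polar

open ContinuousLinearMap (adjoint)

variable {H : Type*} [NormedAddCommGroup H] [InnerProductSpace ℂ H] [CompleteSpace H]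
  {G : Type*} [NormedAddCommGroup G] [InnerProductSpace ℂ G] [CompleteSpace G]

/-- With `R` the square root, `‖R x‖² = (x, R² x) = (x, A* A x) = ‖A x‖²`. Hence `R x ↦ A x` is
isometric. -/
theorem norm_opSqrt_apply (A : H →L[ℂ] G) (x : H) :
    ‖opSqrt (adjoint A ∘L A) x‖ = ‖A x‖ := by
  set M := adjoint A ∘L A with hM
  have h0 : 0 ≤ M := (ContinuousLinearMap.nonneg_iff_isPositive _).2
    (ContinuousLinearMap.isPositive_adjoint_comp_self A)
  have h1 : opSqrt M * opSqrt M = M := CFC.sqrt_mul_sqrt_self M h0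
  have h2 : IsSelfAdjoint (opSqrt M) := (CFC.sqrt_nonneg M).isSelfAdjoint
  have h3 : ⟪opSqrt M x, opSqrt M x⟫_ℂ = ⟪A x, A x⟫_ℂ := by
    have h2' : ⟪opSqrt M x, opSqrt M x⟫_ℂ = ⟪x, opSqrt M (opSqrt M x)⟫_ℂ :=
      (ContinuousLinearMap.isSelfAdjoint_iff_isSymmetric.1 h2) x (opSqrt M x)
    rw [h2']
    change ⟪x, (opSqrt M * opSqrt M) x⟫_ℂ = _
    rw [h1, hM, ContinuousLinearMap.comp_apply, ContinuousLinearMap.adjoint_inner_right]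
  rw [inner_self_eq_norm_sq_to_K, inner_self_eq_norm_sq_to_K] at h3
  have h4 : ‖opSqrt M x‖ ^ 2 = ‖A x‖ ^ 2 := by exact_mod_cast h3
  exact (pow_left_inj₀ (norm_nonneg _) (norm_nonneg _) two_ne_zero).1 h4

theorem opSqrt_injective {A : H →L[ℂ] G} (hA : Function.Injective A) :
    Function.Injective (opSqrt (adjoint A ∘L A)) := by
  rw [injective_iff_map_eq_zero]
  intro x hx
  rw [← norm_eq_zero, norm_opSqrt_apply, norm_eq_zero] at hx
  exact (map_eq_zero_iff A hA).1 hx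

theorem denseRange_of_ker_adjoint {A : H →L[ℂ] G} (hA : ∀ y, adjoint A y = 0 → y = 0) :
    DenseRange A := by
  have h : A.range.topologicalClosure = ⊤ := by
    rw [Submodule.topologicalClosure_eq_top_iff, ContinuousLinearMap.orthogonal_range,
      Submodule.eq_bot_iff]
    exact hA
  exact (Submodule.dense_iff_topologicalClosure_eq_top).2 h

theorem opSqrt_denseRange {A : H →L[ℂ] G} (hA : Function.Injective A) :
    DenseRange (opSqrt (adjoint A ∘L A)) := by
  refine denseRange_of_ker_adjoint fun y hy => ?_
  have h2 : IsSelfAdjoint (opSqrt (adjoint A ∘L A)) :=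
    (CFC.sqrt_nonneg (adjoint A ∘L A)).isSelfAdjoint
  rw [h2.adjoint_eq] at hy
  exact (map_eq_zero_iff _ (opSqrt_injective hA)).1 hy

/-- The unitary part of the polar decomposition of an injective operator with dense range. -/
def polarUnitary {A : H →L[ℂ] G} (hA : Function.Injective A) (hd : DenseRange A) : H ≃ₗᵢ[ℂ] G :=
  (LinearEquiv.refl ℂ H).extendOfIsometry (opSqrt (adjoint A ∘L A)).toLinearMap A.toLinearMap
    (opSqrt_denseRange hA) hd fun x => (norm_opSqrt_apply A x).symm

theorem polarUnitary_opSqrt {A : H →L[ℂ] G} (hA : Function.Injective A) (hd : DenseRange A)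
    (x : H) : polarUnitary hA hd (opSqrt (adjoint A ∘L A) x) = A x :=
  LinearEquiv.extendOfIsometry_eq (LinearEquiv.refl ℂ H) _ _ _ _ _ x

end Polar

/-! ### Kernels and ranges of projections. -/

section Coisometry

open ContinuousLinearMap (adjoint)

variable {H : Type*} [NormedAddCommGroup H] [InnerProductSpace ℂ H] [CompleteSpace H]

theorem ker_adjoint_comp_self (Z : H →L[ℂ] H) : (adjoint Z ∘L Z).ker = Z.ker := by
  ext x
  simp only [LinearMap.mem_ker, ContinuousLinearMap.coe_coe, ContinuousLinearMap.comp_apply]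
  constructor
  · intro h
    have h1 : ⟪adjoint Z (Z x), x⟫_ℂ = 0 := by rw [h, inner_zero_left]
    rwa [ContinuousLinearMap.adjoint_inner_left, inner_self_eq_zero] at h1
  · intro h
    rw [h, map_zero]

theorem range_one_sub_eq_ker {P : H →L[ℂ] H} (hP : IsStarProjection P) :
    (1 - P).range = P.ker := by
  ext x
  constructor
  · rintro ⟨y, rfl⟩
    change P (y - P y) = 0
    rw [map_sub, ← mul_apply_eq_comp, hP.isIdempotentElem.eq, sub_self]
  · intro hx
    refine ⟨x, ?_⟩
    have hx' : P x = 0 := hx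
    change x - P x = x
    rw [hx', sub_zero]

/-- The range of a projection is its set of fixed points and therefore closed, so no closure is
needed in `(ker P)ᗮ = closure (ran P*)`. -/
theorem orthogonal_ker_eq_range {P : H →L[ℂ] H} (hP : IsStarProjection P) :
    P.kerᗮ = P.range := by
  rw [ContinuousLinearMap.orthogonal_ker, hP.isSelfAdjoint.adjoint_eq]
  refine IsClosed.submodule_topologicalClosure_eq ?_
  have h : (P.range : Set H) = {x | P x = x} := by
    ext x
    constructor
    · rintro ⟨y, rfl⟩
      change P (P y) = P y
      rw [← mul_apply_eq_comp, hP.isIdempotentElem.eq]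
    · intro hx
      exact ⟨x, hx⟩
  rw [h]
  exact isClosed_eq P.continuous continuous_id

end Coisometry

/-! ### The factorization `M_F = A* A` and the left translations. -/

section Toeplitz

open FourierTransform
open ContinuousLinearMap (adjoint)
open scoped Real

variable {K : Type*} [NormedAddCommGroup K] [InnerProductSpace ℂ K] [CompleteSpace K]

theorem mulOp_indicator_mem_L2Pos (f : L2Line K) :
    mulOp K volume ((Set.Ici (0 : ℝ)).indicator 1) f ∈ L2Pos K := by
  rw [mem_L2Pos]
  filter_upwards [mulOp_coeFn (.indicator_one measurableSet_Ici) f] with x hx hx0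
  rw [hx, Set.indicator_of_notMem (by simpa using hx0), zero_smul]

theorem starProjection_L2Pos (f : L2Line K) :
    (L2Pos K).starProjection f = mulOp K volume ((Set.Ici (0 : ℝ)).indicator 1) f := by
  refine Submodule.eq_starProjection_of_mem_orthogonal (mulOp_indicator_mem_L2Pos f) ?_
  intro g hg
  rw [L2.inner_def]
  refine integral_eq_zero_of_ae ?_
  filter_upwards [mem_L2Pos.1 hg, mulOp_coeFn (.indicator_one measurableSet_Ici) f,
    Lp.coeFn_sub f (mulOp K volume ((Set.Ici (0 : ℝ)).indicator 1) f)] with x h1 h2 h3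
  rw [h3, Pi.sub_apply, h2, Pi.zero_apply]
  by_cases hx : x < 0
  · rw [h1 hx, inner_zero_left]
  · simp [not_lt.1 hx]

theorem starProjection_L2Pos_coeFn (f : L2Line K) :
    (L2Pos K).starProjection f =ᵐ[volume] (Set.Ici (0 : ℝ)).indicator f := by
  rw [starProjection_L2Pos]
  filter_upwards [mulOp_coeFn (.indicator_one measurableSet_Ici) f] with x hx
  rw [hx]
  by_cases h : x ∈ Set.Ici (0 : ℝ)
  · simp [Set.indicator_of_mem h]
  · simp [Set.indicator_of_notMem h]

theorem coe_orthogonalProjectionOnto_L2Pos (f : L2Line K) :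
    ((L2Pos K).orthogonalProjectionOnto f : L2Line K) =ᵐ[volume]
      (Set.Ici (0 : ℝ)).indicator f :=
  starProjection_L2Pos_coeFn f

theorem orthogonalProjectionOnto_L2Pos_congr {f g : L2Line K}
    (h : ∀ᵐ x : ℝ, 0 ≤ x → f x = g x) :
    (L2Pos K).orthogonalProjectionOnto f = (L2Pos K).orthogonalProjectionOnto g := by
  refine Subtype.ext (Lp.ext ?_)
  filter_upwards [coe_orthogonalProjectionOnto_L2Pos f, coe_orthogonalProjectionOnto_L2Pos g, h]
    with x h1 h2 h3
  rw [h1, h2]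
  by_cases hx : x ∈ Set.Ici (0 : ℝ)
  · rw [Set.indicator_of_mem hx, Set.indicator_of_mem hx, h3 hx]
  · rw [Set.indicator_of_notMem hx, Set.indicator_of_notMem hx]

theorem fourier_sub_L2 (f g : L2Line K) : (𝓕 (f - g) : L2Line K) = 𝓕 f - 𝓕 g :=
  (Lp.fourierTransformₗᵢ ℝ K).map_sub f g

theorem fourierInv_starProjection_mem_fourierPos (f : L2Line K) :
    (𝓕⁻ ((L2Pos K).starProjection f) : L2Line K) ∈ fourierPos K := by
  rw [mem_fourierPos, FourierTransform.fourier_fourierInv_eq]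
  exact mem_L2Pos.1 (Submodule.starProjection_apply_mem _ _)

theorem sub_mem_orthogonal_fourierPos (f : L2Line K) :
    f - 𝓕⁻ ((L2Pos K).starProjection (𝓕 f)) ∈ (fourierPos K)ᗮ := by
  intro g hg
  have hg' : (𝓕 g : L2Line K) ∈ L2Pos K := mem_L2Pos.2 (mem_fourierPos.1 hg)
  rw [← Lp.inner_fourier_eq, fourier_sub_L2, FourierTransform.fourier_fourierInv_eq]
  exact Submodule.sub_starProjection_mem_orthogonal _ _ hg'

/-- By Paley–Wiener the closure of the Hardy space is the preimage of `L²(ℝ⁺; K)` under the unitary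
`𝓕`, so the projections are conjugate under `𝓕`. -/
theorem projHardy_apply (f : L2Line K) :
    projHardy K f = 𝓕⁻ ((L2Pos K).starProjection (𝓕 f)) := by
  have h := topologicalClosure_hardyPlus (K := K)
  rw [projHardy]
  refine Submodule.eq_starProjection_of_mem_orthogonal ?_ ?_
  · rw [h]
    exact fourierInv_starProjection_mem_fourierPos _
  · rw [h]
    exact sub_mem_orthogonal_fourierPos _

variable (K) in
/-- The Fourier transform of `P₊ f`, for `f` in `L²(ℝ⁺; K)`, as an element of `L²(ℝ⁺; K)`. -/
def fourierCompress : L2Pos K →L[ℂ] L2Pos K :=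
  (L2Pos K).orthogonalProjectionOnto ∘L
    (Lp.fourierTransformₗᵢ ℝ K).toContinuousLinearEquiv.toContinuousLinearMap ∘L (L2Pos K).subtypeL

theorem fourierCompress_apply (x : L2Pos K) :
    fourierCompress K x = (L2Pos K).orthogonalProjectionOnto (𝓕 (x : L2Line K)) := rfl

theorem adjoint_fourierCompress_apply (x : L2Pos K) :
    adjoint (fourierCompress K) x = (L2Pos K).orthogonalProjectionOnto (𝓕⁻ (x : L2Line K)) := by
  refine ext_inner_left ℂ fun y => ?_
  rw [ContinuousLinearMap.adjoint_inner_right, fourierCompress_apply,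
    Submodule.inner_orthogonalProjectionOnto_eq_of_mem_right,
    Submodule.inner_orthogonalProjectionOnto_eq_of_mem_left,
    ← Lp.inner_fourier_eq (y : L2Line K), FourierTransform.fourier_fourierInv_eq]

/-- In `P 𝓕⁻¹ P 𝓕` the right-hand `P 𝓕` is `A`, and `P 𝓕⁻¹` on the half-line space is its adjoint.
This relates `Λ_F` to `A`, whose interplay with the evolution is explicit. -/
theorem lyapunov_eq : lyapunov K = adjoint (fourierCompress K) ∘L fourierCompress K := by
  ext1 x
  rw [ContinuousLinearMap.comp_apply, adjoint_fourierCompress_apply, fourierCompress_apply]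
  change (L2Pos K).orthogonalProjectionOnto (projHardy K x) = _
  rw [projHardy_apply]
  rfl

/-- An element of the kernel lives on the positive half-line while its transform vanishes there. -/
theorem fourierCompress_injective : Function.Injective (fourierCompress K) := by
  rw [injective_iff_map_eq_zero]
  intro x hx
  have h1 := coe_orthogonalProjectionOnto_L2Pos (𝓕 (x : L2Line K))
  rw [← fourierCompress_apply, hx] at h1
  refine Subtype.ext (eq_zero_of_fourier_half_line isClosed_Ici isPreconnected_compl_Ici
    (by simpa using mem_L2Pos.1 x.2) (b := -1) (by norm_num) ?_)
  filter_upwards [h1, Lp.coeFn_zero K 2 (volume : Measure ℝ)] with s h2 h3 hs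
  rw [Submodule.coe_zero, h3, Set.indicator_of_mem (by simpa using (by linarith : 0 ≤ s))] at h2
  exact h2.symm

/-- If `A* y = 0`, then `𝓕⁻¹ y` vanishes on the positive half-line and its transform `y` vanishes on
the negative one. -/
theorem fourierCompress_denseRange : DenseRange (fourierCompress K) := by
  refine denseRange_of_ker_adjoint fun y hy => ?_
  have h1 := coe_orthogonalProjectionOnto_L2Pos (𝓕⁻ (y : L2Line K))
  rw [← adjoint_fourierCompress_apply, hy] at h1
  have h2 : (𝓕 (𝓕⁻ (y : L2Line K)) : L2Line K) = y :=
    FourierTransform.fourier_fourierInv_eq _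
  have h0 : (𝓕⁻ (y : L2Line K) : L2Line K) = 0 := by
    refine eq_zero_of_fourier_half_line isClosed_Iic isPreconnected_compl_Iic ?_ (b := 1)
      one_ne_zero ?_
    · filter_upwards [h1, Lp.coeFn_zero K 2 (volume : Measure ℝ)] with s h2 h3 hs
      rw [Submodule.coe_zero, h3, Set.indicator_of_mem (by simpa using (not_le.1 hs).le)] at h2
      exact h2.symm
    · rw [h2]
      simpa using mem_L2Pos.1 y.2
  exact Subtype.ext ((Lp.fourierTransformₗᵢ ℝ K).symm.map_eq_zero_iff.1 h0)

theorem shiftL2_shiftL2_neg (τ : ℝ) (f : L2Line K) : shiftL2 K τ (shiftL2 K (-τ) f) = f := by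
  apply Lp.ext
  filter_upwards [shiftL2_coeFn τ (shiftL2 K (-τ) f),
    (measurePreserving_add_right volume τ).quasiMeasurePreserving.ae (shiftL2_coeFn (-τ) f)]
    with s h1 h2
  rw [h1, h2, add_neg_cancel_right]

theorem inner_shiftL2_left (τ : ℝ) (f g : L2Line K) :
    ⟪shiftL2 K τ f, g⟫_ℂ = ⟪f, shiftL2 K (-τ) g⟫_ℂ := by
  conv_lhs => rw [← shiftL2_shiftL2_neg τ g]
  exact (shiftL2 K τ).inner_map_map _ _

variable (K) in
/-- The translation by `τ`, compressed to `L²(ℝ⁺; K)`. -/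
def shiftPos (τ : ℝ) : L2Pos K →L[ℂ] L2Pos K :=
  (L2Pos K).orthogonalProjectionOnto ∘L (shiftL2 K τ).toContinuousLinearMap ∘L (L2Pos K).subtypeL

theorem shiftPos_apply (τ : ℝ) (x : L2Pos K) :
    shiftPos K τ x = (L2Pos K).orthogonalProjectionOnto (shiftL2 K τ (x : L2Line K)) := rfl

theorem adjoint_shiftPos (τ : ℝ) : adjoint (shiftPos K τ) = shiftPos K (-τ) := by
  ext1 x
  refine ext_inner_left ℂ fun y => ?_
  rw [ContinuousLinearMap.adjoint_inner_right, shiftPos_apply, shiftPos_apply,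
    Submodule.inner_orthogonalProjectionOnto_eq_of_mem_right,
    Submodule.inner_orthogonalProjectionOnto_eq_of_mem_left, inner_shiftL2_left]

theorem shiftPos_coeFn (τ : ℝ) (x : L2Pos K) :
    (shiftPos K τ x : L2Line K) =ᵐ[volume]
      (Set.Ici (0 : ℝ)).indicator fun s => (x : L2Line K) (s + τ) := by
  rw [shiftPos_apply]
  filter_upwards [coe_orthogonalProjectionOnto_L2Pos (shiftL2 K τ (x : L2Line K)),
    shiftL2_coeFn τ (x : L2Line K)] with s h1 h2
  rw [h1]
  by_cases hs : s ∈ Set.Ici (0 : ℝ)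
  · rw [Set.indicator_of_mem hs, Set.indicator_of_mem hs, h2]
  · rw [Set.indicator_of_notMem hs, Set.indicator_of_notMem hs]

theorem shiftPos_shiftPos_neg {τ : ℝ} (hτ : 0 ≤ τ) (x : L2Pos K) :
    shiftPos K τ (shiftPos K (-τ) x) = x := by
  refine Subtype.ext (Lp.ext ?_)
  filter_upwards [shiftPos_coeFn τ (shiftPos K (-τ) x),
    (measurePreserving_add_right volume τ).quasiMeasurePreserving.ae (shiftPos_coeFn (-τ) x),
    mem_L2Pos.1 x.2] with s h1 h2 h3
  rw [h1]
  by_cases hs : s ∈ Set.Ici (0 : ℝ)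
  · have hs' : s + τ ∈ Set.Ici (0 : ℝ) := add_nonneg hs hτ
    rw [Set.indicator_of_mem hs, h2, Set.indicator_of_mem hs', add_neg_cancel_right]
  · rw [Set.indicator_of_notMem hs, h3 (by simpa using hs)]

/-- The left translation discards the values on `[0, τ)`, and translating back fills the gap with
zero. -/
theorem shiftPos_neg_shiftPos {τ : ℝ} (hτ : 0 ≤ τ) (x : L2Pos K) :
    (shiftPos K (-τ) (shiftPos K τ x) : L2Line K) =ᵐ[volume]
      (Set.Ici τ).indicator (x : L2Line K) := by
  filter_upwards [shiftPos_coeFn (-τ) (shiftPos K τ x),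
    (measurePreserving_add_right volume (-τ)).quasiMeasurePreserving.ae (shiftPos_coeFn τ x)]
    with s h1 h2
  rw [h1]
  by_cases hs : s ∈ Set.Ici τ
  · have hs0 : s ∈ Set.Ici (0 : ℝ) := hτ.trans hs
    have hs' : s + -τ ∈ Set.Ici (0 : ℝ) := by
      rw [Set.mem_Ici] at hs ⊢
      linarith
    rw [Set.indicator_of_mem hs, Set.indicator_of_mem hs0, h2, Set.indicator_of_mem hs',
      neg_add_cancel_right]
  · rw [Set.indicator_of_notMem hs]
    by_cases hs0 : s ∈ Set.Ici (0 : ℝ)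
    · have hs' : s + -τ ∉ Set.Ici (0 : ℝ) := by
        rw [Set.mem_Ici] at hs ⊢
        intro h
        linarith
      rw [Set.indicator_of_mem hs0, h2, Set.indicator_of_notMem hs']
    · rw [Set.indicator_of_notMem hs0]

/-- For `s ≥ 0` the translated function uses only values at `s + t / 2π ≥ 0`, so the part of the
transform cut off by the compression has no influence. This is where `t ≥ 0` enters. -/
theorem fourierCompress_evolPos {t : ℝ} (ht : 0 ≤ t) (x : L2Pos K) :
    fourierCompress K (evolPos K t x) = shiftPos K (t / (2 * π)) (fourierCompress K x) := by
  have hτ : 0 ≤ t / (2 * π) := by positivity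
  have h0 : (𝓕 (evolPos K t x : L2Line K) : L2Line K) =
      shiftL2 K (t / (2 * π)) (𝓕 (x : L2Line K)) := fourier_evol t (x : L2Line K)
  rw [fourierCompress_apply, h0, shiftPos_apply, fourierCompress_apply]
  refine orthogonalProjectionOnto_L2Pos_congr ?_
  filter_upwards [shiftL2_coeFn (t / (2 * π)) (𝓕 (x : L2Line K)),
    shiftL2_coeFn (t / (2 * π))
      ((L2Pos K).orthogonalProjectionOnto (𝓕 (x : L2Line K)) : L2Line K),
    (measurePreserving_add_right volume (t / (2 * π))).quasiMeasurePreserving.ae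
      (coe_orthogonalProjectionOnto_L2Pos (𝓕 (x : L2Line K)))] with s h1 h2 h3 hs
  have hs' : s + t / (2 * π) ∈ Set.Ici (0 : ℝ) := add_nonneg hs hτ
  rw [h1, h2, h3, Set.indicator_of_mem hs']

end Toeplitz

/-! ### The operators `Z(t)` as left translations, and the ordering operator. -/

section Representation

open ContinuousLinearMap (adjoint)
open scoped Real

variable {K : Type*} [NormedAddCommGroup K] [InnerProductSpace ℂ K]

theorem indicator_Ici_ae_eq (f : L2Pos K) :
    (Set.Ici (0 : ℝ)).indicator (f : L2Line K) =ᵐ[volume] (f : L2Line K) := by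
  filter_upwards [mem_L2Pos.1 f.2] with x hx
  by_cases h : x ∈ Set.Ici (0 : ℝ)
  · rw [Set.indicator_of_mem h]
  · rw [Set.indicator_of_notMem h, hx (by simpa using h)]

theorem norm_restrict_L2Pos (f : L2Pos K) :
    ‖LpToLpRestrictCLM ℝ K ℂ (volume : Measure ℝ) 2 (Set.Ici 0) (f : L2Line K)‖ = ‖f‖ := by
  change _ = ‖(f : L2Line K)‖
  rw [Lp.norm_def, Lp.norm_def,
    eLpNorm_congr_ae (LpToLpRestrictCLM_coeFn ℂ (Set.Ici 0) (f : L2Line K)),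
    ← eLpNorm_indicator_eq_eLpNorm_restrict measurableSet_Ici,
    eLpNorm_congr_ae (indicator_Ici_ae_eq f)]

variable (K) in
/-- The identification of `L²(ℝ⁺; K)`, as a subspace of `L²(ℝ; K)`, with the `L²` space of the
restriction of Lebesgue measure to `ℝ⁺`. -/
def restrictPos : L2Pos K ≃ₗᵢ[ℂ] Lp K 2 ((volume : Measure ℝ).restrict (Set.Ici 0)) :=
  LinearIsometryEquiv.ofSurjective
    { toLinearMap := (LpToLpRestrictCLM ℝ K ℂ (volume : Measure ℝ) 2 (Set.Ici 0)).toLinearMap ∘ₗ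
        (L2Pos K).subtype
      norm_map' := norm_restrict_L2Pos }
    (fun g => by
      have hg : MemLp ((Set.Ici (0 : ℝ)).indicator g) 2 volume :=
        (memLp_indicator_iff_restrict measurableSet_Ici).2 (Lp.memLp g)
      refine ⟨⟨hg.toLp _, ?_⟩, Lp.ext ?_⟩
      · rw [mem_L2Pos]
        filter_upwards [hg.coeFn_toLp] with x hx hx0
        rw [hx, Set.indicator_of_notMem (by simpa using hx0)]
      · refine (LpToLpRestrictCLM_coeFn ℂ (Set.Ici 0) (hg.toLp _)).trans ?_
        filter_upwards [ae_restrict_of_ae hg.coeFn_toLp, ae_restrict_mem measurableSet_Ici]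
          with x hx hx0
        rw [hx, Set.indicator_of_mem hx0])

theorem restrictPos_coeFn (f : L2Pos K) :
    restrictPos K f =ᵐ[volume.restrict (Set.Ici 0)] (f : L2Line K) :=
  LpToLpRestrictCLM_coeFn ℂ (Set.Ici 0) (f : L2Line K)

/-- The spectral variable `2πs` on the half-line. -/
def energyTime (s : ℝ) : ℝ≥0 := (2 * π * s).toNNReal

theorem measurable_energyTime : Measurable energyTime := by
  unfold energyTime
  fun_prop

/-- The truncation in `energyTime` concerns negative `s` only, a null set for the restricted
measure. -/
theorem energyTime_of_nonneg {s : ℝ} (hs : 0 ≤ s) : (energyTime s : ℝ) = 2 * π * s :=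
  Real.coe_toNNReal _ (by positivity)

/-- Excludes eigenvalues, and makes the end point `t` common to `[0, t]` and `[t, ∞)` harmless. -/
theorem energyTime_preimage_singleton (l : ℝ≥0) :
    (volume : Measure ℝ).restrict (Set.Ici 0) (energyTime ⁻¹' {l}) = 0 := by
  rw [Measure.restrict_apply (measurable_energyTime (measurableSet_singleton l))]
  refine measure_mono_null (t := {(l : ℝ) / (2 * π)}) ?_ Real.volume_singleton
  rintro s ⟨hs, hs0⟩
  have h1 : energyTime s = l := hs
  rw [Set.mem_singleton_iff, eq_div_iff (by positivity), ← h1, energyTime_of_nonneg hs0, mul_comm]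

theorem volume_Ico_div_ne_zero {a b : ℝ} (ha : 0 ≤ a) (hab : a < b) :
    (volume : Measure ℝ).restrict (Set.Ici 0) (Set.Ico (a / (2 * π)) (b / (2 * π))) ≠ 0 := by
  have h : Set.Ico (a / (2 * π)) (b / (2 * π)) ⊆ Set.Ici 0 := fun s hs =>
    (show 0 ≤ a / (2 * π) by positivity).trans hs.1
  rw [Measure.restrict_eq_self _ h, Real.volume_Ico, ne_eq, ENNReal.ofReal_eq_zero, not_le, sub_pos]
  gcongr

theorem energyTime_of_mem_Ico {a b s : ℝ} (ha : 0 ≤ a)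
    (hs : s ∈ Set.Ico (a / (2 * π)) (b / (2 * π))) :
    a ≤ energyTime s ∧ (energyTime s : ℝ) < b := by
  have h2 : (0 : ℝ) < 2 * π := by positivity
  rw [energyTime_of_nonneg ((show 0 ≤ a / (2 * π) by positivity).trans hs.1)]
  have h3 := (div_le_iff₀ h2).1 hs.1
  have h4 := (lt_div_iff₀ h2).1 hs.2
  constructor <;> linarith

theorem energyTime_essential_range (l : ℝ≥0) (ε : ℝ) (hε : 0 < ε) :
    ∃ s, MeasurableSet s ∧ (volume : Measure ℝ).restrict (Set.Ici 0) s ≠ 0 ∧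
      (volume : Measure ℝ).restrict (Set.Ici 0) s ≠ ∞ ∧
      ∀ x ∈ s, |(energyTime x : ℝ) - l| ≤ ε := by
  refine ⟨Set.Ico ((l : ℝ) / (2 * π)) ((l + ε) / (2 * π)), measurableSet_Ico,
    volume_Ico_div_ne_zero l.coe_nonneg (by linarith), ?_, fun x hx => ?_⟩
  · exact ((Measure.restrict_apply_le _ _).trans_lt measure_Ico_lt_top).ne
  · obtain ⟨h1, h2⟩ := energyTime_of_mem_Ico l.coe_nonneg hx
    rw [abs_le]
    constructor <;> linarith

variable [CompleteSpace K]

theorem lambdaF_eq : lambdaF K = opSqrt (adjoint (fourierCompress K) ∘L fourierCompress K) := by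
  rw [lambdaF, lyapunov_eq]

theorem lambdaF_injective : Function.Injective (lambdaF K) := by
  rw [lambdaF_eq]
  exact opSqrt_injective fourierCompress_injective

theorem lambdaF_denseRange : DenseRange (lambdaF K) := by
  rw [lambdaF_eq]
  exact opSqrt_denseRange fourierCompress_injective

theorem norm_lambdaF_apply (x : L2Pos K) : ‖lambdaF K x‖ = ‖fourierCompress K x‖ := by
  rw [lambdaF_eq]
  exact norm_opSqrt_apply _ _

/-- `‖Λ_F u₊(t) x‖ = ‖A u₊(t) x‖ = ‖S(t) A x‖ ≤ ‖S(t)‖ ‖Λ_F x‖`. This is the bound by which `Λ_F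
u₊(t) Λ_F⁻¹` extends continuously. -/
theorem norm_lambdaF_evolPos_le (t : ℝ≥0) (x : L2Pos K) :
    ‖lambdaF K (evolPos K t x)‖ ≤ ‖shiftPos K (t / (2 * π))‖ * ‖lambdaF K x‖ := by
  rw [norm_lambdaF_apply, norm_lambdaF_apply, fourierCompress_evolPos t.coe_nonneg]
  exact ContinuousLinearMap.le_opNorm _ _

theorem Z_lambdaF (t : ℝ≥0) (x : L2Pos K) :
    Z K t (lambdaF K x) = lambdaF K (evolPos K t x) :=
  LinearMap.extendOfNorm_eq lambdaF_denseRange ⟨_, norm_lambdaF_evolPos_le t⟩ x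

variable (K) in
/-- The unitary equivalence of the operators `Z(t)` with the left shifts on `L²(ℝ⁺; K)`. -/
def shiftEquiv : L2Pos K ≃ₗᵢ[ℂ] L2Pos K :=
  polarUnitary fourierCompress_injective fourierCompress_denseRange

theorem shiftEquiv_lambdaF (x : L2Pos K) : shiftEquiv K (lambdaF K x) = fourierCompress K x := by
  rw [lambdaF_eq]
  exact polarUnitary_opSqrt _ _ x

/-- Both sides are continuous, and on the dense range of `Λ_F` the identity is the intertwining
relation of `A`. -/
theorem shiftEquiv_Z (t : ℝ≥0) (x : L2Pos K) :
    shiftEquiv K (Z K t x) = shiftPos K (t / (2 * π)) (shiftEquiv K x) := by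
  refine lambdaF_denseRange.induction_on
    (p := fun x => shiftEquiv K (Z K t x) = shiftPos K (t / (2 * π)) (shiftEquiv K x)) x
    (isClosed_eq (by fun_prop) (by fun_prop)) fun y => ?_
  rw [Z_lambdaF, shiftEquiv_lambdaF, shiftEquiv_lambdaF, fourierCompress_evolPos t.coe_nonneg]

theorem shiftEquiv_adjoint_Z (t : ℝ≥0) (x : L2Pos K) :
    shiftEquiv K (adjoint (Z K t) x) = shiftPos K (-(t / (2 * π))) (shiftEquiv K x) := by
  refine ext_inner_right ℂ fun y => ?_
  obtain ⟨z, rfl⟩ := (shiftEquiv K).surjective y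
  rw [← adjoint_shiftPos, ContinuousLinearMap.adjoint_inner_left, ← shiftEquiv_Z,
    LinearIsometryEquiv.inner_map_map, LinearIsometryEquiv.inner_map_map,
    ContinuousLinearMap.adjoint_inner_left]

/-- Translating right and then back left loses nothing. The commutator of `Z(t)` and its adjoint is
therefore the projection complementary to `Z(t)* Z(t)`. -/
theorem Z_comp_adjoint (t : ℝ≥0) : Z K t ∘L adjoint (Z K t) = 1 := by
  ext1 x
  apply (shiftEquiv K).injective
  rw [ContinuousLinearMap.comp_apply, shiftEquiv_Z, shiftEquiv_adjoint_Z,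
    shiftPos_shiftPos_neg (by positivity), one_apply_eq_self]

variable (K) in
/-- The spectral representation of the temporal ordering operator. -/
def orderingEquiv : L2Pos K ≃ₗᵢ[ℂ] Lp K 2 ((volume : Measure ℝ).restrict (Set.Ici 0)) :=
  (shiftEquiv K).trans (restrictPos K)

variable (K) in
/-- The spectral measure of the temporal ordering operator. -/
def orderingMeasure : ProjMeasure ℝ≥0 (L2Pos K) :=
  mulPVM (orderingEquiv K) measurable_energyTime

theorem orderingMeasure_proj (s : Set ℝ≥0) : (orderingMeasure K).proj s =
    conjMul (orderingEquiv K) ((energyTime ⁻¹' s).indicator 1) := rfl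

/-- In the translation picture the left side cuts off `[0, t / 2π)`, and for `s ≥ 0` the condition
`s ≥ t / 2π` says `energyTime s ≥ t`. -/
theorem adjoint_comp_Z (t : ℝ≥0) :
    adjoint (Z K t) ∘L Z K t = (orderingMeasure K).proj (Set.Ici t) := by
  ext1 x
  apply (orderingEquiv K).injective
  rw [orderingMeasure_proj, conjMul_apply, LinearIsometryEquiv.apply_symm_apply,
    ContinuousLinearMap.comp_apply]
  apply Lp.ext
  have h0 : orderingEquiv K (adjoint (Z K t) (Z K t x)) = restrictPos K
      (shiftPos K (-(t / (2 * π))) (shiftPos K (t / (2 * π)) (shiftEquiv K x))) := by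
    rw [← shiftEquiv_Z, ← shiftEquiv_adjoint_Z]
    rfl
  rw [h0]
  filter_upwards [restrictPos_coeFn
      (shiftPos K (-(t / (2 * π))) (shiftPos K (t / (2 * π)) (shiftEquiv K x))),
    ae_restrict_of_ae (shiftPos_neg_shiftPos (show 0 ≤ (t : ℝ) / (2 * π) by positivity)
      (shiftEquiv K x)),
    mulOp_coeFn (.indicator_one (measurable_energyTime (measurableSet_Ici (a := t))))
      (orderingEquiv K x), restrictPos_coeFn (shiftEquiv K x),
    ae_restrict_mem (measurableSet_Ici (a := (0 : ℝ)))] with s h1 h2 h3 h4 hs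
  have h5 : orderingEquiv K x s = (shiftEquiv K x : L2Line K) s := h4
  have h6 : s ∈ energyTime ⁻¹' Set.Ici t ↔ s ∈ Set.Ici ((t : ℝ) / (2 * π)) := by
    rw [Set.mem_preimage, Set.mem_Ici, Set.mem_Ici, div_le_iff₀ (by positivity),
      ← NNReal.coe_le_coe, energyTime_of_nonneg hs, mul_comm]
  rw [h1, h2, h3, h5]
  by_cases h : s ∈ Set.Ici ((t : ℝ) / (2 * π))
  · rw [Set.indicator_of_mem h, Set.indicator_of_mem (h6.2 h), Pi.one_apply, one_smul]
  · rw [Set.indicator_of_notMem h, Set.indicator_of_notMem (h6.not.2 h), zero_smul]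

theorem orderingMeasure_Icc (t : ℝ≥0) : (orderingMeasure K).proj (Set.Icc 0 t) =
    1 - (orderingMeasure K).proj (Set.Ici t) := by
  ext1 x
  apply (orderingEquiv K).injective
  rw [sub_apply, one_apply_eq_self, map_sub, orderingMeasure_proj, orderingMeasure_proj,
    conjMul_apply, conjMul_apply, LinearIsometryEquiv.apply_symm_apply,
    LinearIsometryEquiv.apply_symm_apply]
  apply Lp.ext
  have h0 : ∀ᵐ s ∂(volume : Measure ℝ).restrict (Set.Ici 0), energyTime s ≠ t :=
    measure_eq_zero_iff_ae_notMem.1 (energyTime_preimage_singleton t)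
  filter_upwards [h0,
    mulOp_coeFn (.indicator_one (measurable_energyTime (measurableSet_Ici (a := t))))
      (orderingEquiv K x),
    mulOp_coeFn (.indicator_one (measurable_energyTime (measurableSet_Icc (a := 0) (b := t))))
      (orderingEquiv K x), Lp.coeFn_sub (orderingEquiv K x) (mulOp K _
        ((energyTime ⁻¹' Set.Ici t).indicator 1) (orderingEquiv K x))] with s hs h1 h2 h3
  rw [h2, h3, Pi.sub_apply, h1]
  rcases lt_or_gt_of_ne hs with h | h
  · have h4 : s ∈ energyTime ⁻¹' Set.Icc 0 t := ⟨zero_le, h.le⟩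
    have h5 : s ∉ energyTime ⁻¹' Set.Ici t := fun h' => h.not_ge h'
    simp [h4, h5]
  · have h4 : s ∉ energyTime ⁻¹' Set.Icc 0 t := fun h' => h.not_ge h'.2
    have h5 : s ∈ energyTime ⁻¹' Set.Ici t := h.le
    simp [h4, h5]

theorem Z_comp_adjoint_sub (t : ℝ≥0) : Z K t ∘L adjoint (Z K t) - adjoint (Z K t) ∘L Z K t =
    (orderingMeasure K).proj (Set.Icc 0 t) := by
  rw [Z_comp_adjoint, adjoint_comp_Z, orderingMeasure_Icc]

theorem orderingMeasure_Ici_isStarProjection (t : ℝ≥0) :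
    IsStarProjection ((orderingMeasure K).proj (Set.Ici t)) :=
  (orderingMeasure K).isStarProjection _ measurableSet_Ici

theorem ker_Z (t : ℝ≥0) : (Z K t).ker = ((orderingMeasure K).proj (Set.Ici t)).ker := by
  rw [← adjoint_comp_Z, ker_adjoint_comp_self]

theorem range_orderingMeasure_Icc (t : ℝ≥0) :
    ((orderingMeasure K).proj (Set.Icc 0 t)).range = (Z K t).ker := by
  rw [orderingMeasure_Icc, ker_Z, range_one_sub_eq_ker (orderingMeasure_Ici_isStarProjection (K := K) t)]

theorem range_orderingMeasure_Ici (t : ℝ≥0) :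
    ((orderingMeasure K).proj (Set.Ici t)).range = (Z K t).kerᗮ := by
  rw [ker_Z, orthogonal_ker_eq_range (orderingMeasure_Ici_isStarProjection (K := K) t)]

theorem mem_ker_Z {t : ℝ≥0} {x : L2Pos K} :
    x ∈ (Z K t).ker ↔ (orderingMeasure K).proj (Set.Ici t) x = 0 := by
  rw [ker_Z]
  rfl

theorem ker_Z_zero : (Z K 0).ker = ⊥ := by
  rw [Submodule.eq_bot_iff]
  intro x hx
  rw [mem_ker_Z, show Set.Ici (0 : ℝ≥0) = Set.univ from Set.Ici_bot,
    (orderingMeasure K).proj_univ] at hx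
  exact hx

theorem ker_Z_mono {t₁ t₂ : ℝ≥0} (h : t₁ ≤ t₂) : (Z K t₁).ker ≤ (Z K t₂).ker := by
  intro x hx
  rw [mem_ker_Z] at hx ⊢
  rw [← Set.inter_eq_left.2 (Set.Ici_subset_Ici.2 h),
    (orderingMeasure K).proj_inter _ _ measurableSet_Ici measurableSet_Ici, mul_apply_eq_comp, hx,
    map_zero]

/-- The witness is a non-zero constant vector on `[t₁ / 2π, t₂ / 2π)`, which the projection leaves
unchanged. -/
theorem exists_orderingMeasure_proj_ne_zero [Nontrivial K] {t₁ t₂ : ℝ≥0} (h : t₁ < t₂) :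
    (orderingMeasure K).proj (Set.Ico t₁ t₂) ≠ 0 := by
  obtain ⟨k, hk⟩ := exists_ne (0 : K)
  set ν := (volume : Measure ℝ).restrict (Set.Ici 0)
  set s := Set.Ico ((t₁ : ℝ) / (2 * π)) ((t₂ : ℝ) / (2 * π))
  have hs : ν s ≠ 0 := volume_Ico_div_ne_zero t₁.coe_nonneg h
  have hs' : ν s ≠ ∞ := ((Measure.restrict_apply_le _ _).trans_lt measure_Ico_lt_top).ne
  intro h0
  have h1 := congrArg (fun A : L2Pos K →L[ℂ] L2Pos K =>
    orderingEquiv K (A ((orderingEquiv K).symm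
      (indicatorConstLp 2 (measurableSet_Ico (a := (t₁ : ℝ) / (2 * π))) hs' k)))) h0
  simp only [orderingMeasure_proj, conjMul_apply, LinearIsometryEquiv.apply_symm_apply,
    zero_apply, map_zero] at h1
  have h2 := mulOp_coeFn (K := K) (ν := ν)
    (.indicator_one (measurable_energyTime (measurableSet_Ico (a := t₁) (b := t₂))))
    (indicatorConstLp 2 measurableSet_Ico hs' k)
  rw [h1] at h2
  refine hs (measure_eq_zero_iff_ae_notMem.2 ?_)
  filter_upwards [h2, indicatorConstLp_coeFn (p := 2) (hs := measurableSet_Ico) (hμs := hs')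
    (c := k), Lp.coeFn_zero K 2 ν] with r h3 h4 h5 hr
  obtain ⟨h6, h7⟩ := energyTime_of_mem_Ico t₁.coe_nonneg hr
  have h8 : r ∈ energyTime ⁻¹' Set.Ico t₁ t₂ := ⟨h6, h7⟩
  rw [h5, h4, Set.indicator_of_mem h8, Set.indicator_of_mem hr] at h3
  exact hk (by simpa using h3.symm)

/-- The range of the projection of `[t₁, t₂)` lies in `ker Z(t₂)` and meets `ker Z(t₁)` only in
zero. -/
theorem ker_Z_strictMono [Nontrivial K] {t₁ t₂ : ℝ≥0} (h : t₁ < t₂) :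
    (Z K t₁).ker < (Z K t₂).ker := by
  refine lt_of_le_not_ge (ker_Z_mono h.le) fun hle =>
    exists_orderingMeasure_proj_ne_zero (K := K) h ?_
  ext1 x
  have h1 : (orderingMeasure K).proj (Set.Ico t₁ t₂) x ∈ (Z K t₂).ker := by
    rw [mem_ker_Z, ← mul_apply_eq_comp,
      ← (orderingMeasure K).proj_inter _ _ measurableSet_Ici measurableSet_Ico,
      show Set.Ici t₂ ∩ Set.Ico t₁ t₂ = ∅ from
        Set.eq_empty_of_forall_notMem fun r hr => hr.2.2.not_ge hr.1,
      (orderingMeasure K).proj_empty, zero_apply]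
  have h2 := mem_ker_Z.1 (hle h1)
  rwa [← mul_apply_eq_comp,
    ← (orderingMeasure K).proj_inter _ _ measurableSet_Ici measurableSet_Ico,
    Set.inter_eq_right.2 Set.Ico_subset_Ici_self] at h2

theorem starProjection_ker_Z (t : ℝ≥0) (x : L2Pos K) :
    (Z K t).ker.starProjection x = x - (orderingMeasure K).proj (Set.Ici t) x := by
  refine Submodule.eq_starProjection_of_mem_orthogonal ?_ ?_
  · rw [mem_ker_Z, map_sub, ← mul_apply_eq_comp,
      (orderingMeasure_Ici_isStarProjection t).isIdempotentElem.eq, sub_self]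
  · rw [sub_sub_cancel, ← range_orderingMeasure_Ici]
    exact ⟨x, rfl⟩

/-- The squared norms are the values of a finite measure on sets that decrease to the empty set. -/
theorem tendsto_orderingMeasure_Ici (x : L2Pos K) :
    Tendsto (fun t => (orderingMeasure K).proj (Set.Ici t) x) atTop (𝓝 0) := by
  have h1 (t : ℝ≥0) : ‖(orderingMeasure K).proj (Set.Ici t) x‖ₑ ^ 2 =
      sqMeasure (orderingEquiv K x) (energyTime ⁻¹' Set.Ici t) := by
    rw [← enorm_sq_mulOp_indicator (measurable_energyTime measurableSet_Ici), orderingMeasure_proj,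
      conjMul_apply]
    congr 1
    exact congrArg ENNReal.ofNNReal ((orderingEquiv K).symm.nnnorm_map _)
  have h2 : ⋂ t : ℝ≥0, energyTime ⁻¹' Set.Ici t = ∅ :=
    Set.eq_empty_of_forall_notMem fun s hs => by
      have h3 : energyTime s + 1 ≤ energyTime s := Set.mem_iInter.1 hs (energyTime s + 1)
      exact (lt_add_one (energyTime s)).not_ge h3
  have h3 := tendsto_measure_iInter_atTop (μ := sqMeasure (orderingEquiv K x))
    (s := fun t : ℝ≥0 => energyTime ⁻¹' Set.Ici t)
    (fun t => (measurable_energyTime measurableSet_Ici).nullMeasurableSet)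
    (fun a b hab => Set.preimage_mono (Set.Ici_subset_Ici.2 hab)) ⟨0, measure_ne_top _ _⟩
  rw [h2, measure_empty] at h3
  rw [tendsto_zero_iff_norm_tendsto_zero]
  have h4 : Tendsto (fun t => ‖(orderingMeasure K).proj (Set.Ici t) x‖ ^ 2) atTop (𝓝 0) := by
    have h5 := (ENNReal.tendsto_toReal ENNReal.zero_ne_top).comp h3
    refine h5.congr fun t => ?_
    rw [Function.comp_apply, Function.comp_apply, ← h1, ENNReal.toReal_pow, toReal_enorm]
  have h6 := h4.sqrt
  simpa [Real.sqrt_sq] using h6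

theorem tendsto_starProjection_ker_Z (x : L2Pos K) :
    Tendsto (fun t : ℝ≥0 => (Z K t).ker.starProjection x) atTop (𝓝 x) := by
  have h := (tendsto_const_nhds (x := x)).sub (tendsto_orderingMeasure_Ici x)
  rw [sub_zero] at h
  exact h.congr fun t => (starProjection_ker_Z t x).symm

end Representation

end

end TimeOrdering

theorem theorem3 (K : Type*) [NormedAddCommGroup K] [InnerProductSpace ℂ K] [CompleteSpace K]
    [TopologicalSpace.SeparableSpace K] [Nontrivial K] :
    -- the operators `Z(t)` are well defined by `Z(t) Λ_F = Λ_F u₊(t)`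
    (Function.Injective (TimeOrdering.lambdaF K) ∧ DenseRange (TimeOrdering.lambdaF K) ∧
      ∀ t : ℝ≥0, TimeOrdering.Z K t ∘L TimeOrdering.lambdaF K =
        TimeOrdering.lambdaF K ∘L TimeOrdering.evolPos K (t : ℝ)) ∧
    -- the temporal ordering operator and its spectral measure
    (∃ (T : TimeOrdering.L2Pos K →ₗ.[ℂ] TimeOrdering.L2Pos K)
        (μ : TimeOrdering.ProjMeasure ℝ≥0 (TimeOrdering.L2Pos K)),
      Dense (T.domain : Set (TimeOrdering.L2Pos K)) ∧
      IsSelfAdjoint T ∧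
      (∀ x : T.domain, 0 ≤ (⟪(x : TimeOrdering.L2Pos K), T x⟫_ℂ).re) ∧
      TimeOrdering.spectrumPMap T = ((↑) : ℝ → ℂ) '' Set.Ici 0 ∧
      TimeOrdering.contSpectrumPMap T = TimeOrdering.spectrumPMap T ∧
      TimeOrdering.IsSpectralMeasure μ T ∧
      ∀ t : ℝ≥0,
        ((μ.proj (Set.Icc 0 t)).range =
            (TimeOrdering.Z K t ∘L ContinuousLinearMap.adjoint (TimeOrdering.Z K t) -
              ContinuousLinearMap.adjoint (TimeOrdering.Z K t) ∘L TimeOrdering.Z K t).range ∧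
          (μ.proj (Set.Icc 0 t)).range = (TimeOrdering.Z K t).ker) ∧
        ((μ.proj (Set.Ici t)).range =
            (ContinuousLinearMap.adjoint (TimeOrdering.Z K t) ∘L TimeOrdering.Z K t).range ∧
          (μ.proj (Set.Ici t)).range = (TimeOrdering.Z K t).kerᗮ)) ∧
    -- the past subspaces
    (∀ t₁ t₂ : ℝ≥0, t₁ < t₂ → (TimeOrdering.Z K t₁).ker < (TimeOrdering.Z K t₂).ker) ∧
    (TimeOrdering.Z K 0).ker = ⊥ ∧
    ∀ ψ : TimeOrdering.L2Pos K,
      Tendsto (fun t : ℝ≥0 => (TimeOrdering.Z K t).ker.starProjection ψ) atTop (𝓝 ψ) := by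
  open TimeOrdering in
  -- The witness for `T` is multiplication by `2πs` in the representation `orderingEquiv`.
  refine ⟨⟨lambdaF_injective, lambdaF_denseRange, fun t => ContinuousLinearMap.ext (Z_lambdaF t)⟩,
    ⟨mulPMap (orderingEquiv K) energyTime, orderingMeasure K,
      mulPMap_dense_domain _ measurable_energyTime, mulPMap_isSelfAdjoint _ measurable_energyTime,
      mulPMap_nonneg _ _, spectrumPMap_mulPMap _ measurable_energyTime energyTime_essential_range,
      contSpectrumPMap_mulPMap _ measurable_energyTime energyTime_essential_range
        energyTime_preimage_singleton,
      mulPMap_isSpectralMeasure _ measurable_energyTime, fun t => ?_⟩,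
    fun _ _ h => ker_Z_strictMono h, ker_Z_zero, tendsto_starProjection_ker_Z⟩
  rw [Z_comp_adjoint_sub, adjoint_comp_Z]
  exact ⟨⟨rfl, range_orderingMeasure_Icc t⟩, rfl, range_orderingMeasure_Ici t⟩
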